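/- Let $p$ be an odd prime, let $G$ be a finite group, let $P$ be a Sylow $p$-subgroup of $G$, and let $\mathcal F = \mathcal F_P(G)$ be the fusion system of $G$ on $P$, i.e. the category whose objects are the subgroups of $P$ and whose morphisms $Q \to R$ are the maps $x \mapsto g^{-1}xg$ with $g \in G$, $g^{-1}Qg \le R$. Then $\mathcal F$ is $Qd(p)$-free if and only if $G$ does not involve $Qd(p)$. Here $Qd(p) = \mathbb F_p^2 \rtimes SL_2(p)$ with respect to the natural action, and a group involves $Qd(p)$ if it has subgroups $K \trianglelefteq H$ with $H/K \cong Qd(p)$. A subgroup $Q \le P$ is fully $\mathcal F$-normalised if $|N_P(Q)| \ge |N_P(Q\varphi)|$, and $\mathcal F$-centric if $C_P(Q\varphi) \le Q\varphi$, for every morphism $\varphi$ of $\mathcal F$ with domain $Q$. The normaliser $\mathcal N_{\mathcal F}(Q)$ is the fusion system on $N_P(Q)$ whose morphisms $R \to T$ are those morphisms of $\mathcal F$ that extend to an $\mathcal F$-morphism $RQ \to TQ$ restricting to an $\mathcal F$-automorphism of $Q$. A model of a fusion system $\mathcal E$ on a finite $p$-group $S$ is a finite group $L$ with Sylow $p$-subgroup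 $S$ such that $C_L(O_p(L)) \le O_p(L)$, $O_{p'}(L) = 1$ and $\mathcal E = \mathcal F_S(L)$. Finally, $\mathcal F$ is $Qd(p)$-free if, for every $\mathcal F$-centric and fully $\mathcal F$-normalised subgroup $Q$ of $P$, no model of $\mathcal N_{\mathcal F}(Q)$ involves $Qd(p)$. -/

import Mathlib

universe u

/-- A finite group `G` involves `X` if some section `H / K` of `G` is isomorphic to `X`. -/
def Involves (G X : Type*) [Group G] [Group X] : Prop :=
  ∃ (H : Subgroup G) (K : Subgroup H) (_ : K.Normal), Nonempty (H ⧸ K ≃* X)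

/-- The natural action of `SL₂(p)` on the (multiplicatively written) vector space `𝔽_p²`. -/
def Qd.action (p : ℕ) :
    Matrix.SpecialLinearGroup (Fin 2) (ZMod p) →* MulAut (Multiplicative (Fin 2 → ZMod p)) where
  toFun A := AddEquiv.toMultiplicative (Matrix.SpecialLinearGroup.toLin' A).toAddEquiv
  map_one' := by ext; simp
  map_mul' A B := by ext; simp

/-- The group `Qd(p) = 𝔽_p² ⋊ SL₂(p)`. -/
abbrev Qd (p : ℕ) : Type :=
  Multiplicative (Fin 2 → ZMod p) ⋊[Qd.action p] Matrix.SpecialLinearGroup (Fin 2) (ZMod p)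

/-- `O_p(L)`: the largest normal `p`-subgroup of the finite group `L`. -/
def pCore (p : ℕ) (L : Type*) [Group L] : Subgroup L :=
  sSup {N : Subgroup L | N.Normal ∧ IsPGroup p N}

/-- `O_{p'}(L)`: the largest normal subgroup of order prime to `p` of the finite group `L`. -/
def pPrimeCore (p : ℕ) (L : Type*) [Group L] : Subgroup L :=
  sSup {N : Subgroup L | N.Normal ∧ (Nat.card N).Coprime p}

/-- A fusion system on the group `P`: a category whose objects are the subgroups of `P` and whose
morphisms are injective group homomorphisms, containing all conjugations by elements of `P`, and
such that the isomorphism onto the image of a morphism and its inverse are again morphisms.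
(The saturation axioms enter none of the notions defined below; they hold automatically for the
fusion system of a finite group on a Sylow subgroup.) -/
@[ext]
structure FusionSystem (P : Type u) [Group P] where
  /-- the morphisms from `Q` to `R` -/
  Hom : ∀ Q R : Subgroup P, Set (Q →* R)
  injective : ∀ {Q R : Subgroup P} {φ : Q →* R}, φ ∈ Hom Q R → Function.Injective φ
  id_mem : ∀ Q : Subgroup P, MonoidHom.id Q ∈ Hom Q Q
  comp_mem : ∀ {Q R T : Subgroup P} {φ : Q →* R} {ψ : R →* T},
    φ ∈ Hom Q R → ψ ∈ Hom R T → ψ.comp φ ∈ Hom Q T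
  conj_mem : ∀ {Q R : Subgroup P} (g : P) (φ : Q →* R),
    (∀ x : Q, (φ x : P) = g⁻¹ * x * g) → φ ∈ Hom Q R
  /-- `S` is here necessarily the image of `φ`, and `e` is `φ` with restricted codomain. -/
  iso_mem : ∀ {Q R S : Subgroup P} {φ : Q →* R}, φ ∈ Hom Q R → ∀ e : Q ≃* S,
    (∀ x : Q, (e x : P) = φ x) → e.toMonoidHom ∈ Hom Q S ∧ e.symm.toMonoidHom ∈ Hom S Q

namespace FusionSystem

/-- The fusion system on `P` of a group `G` into which `P` is embedded by `ι`: the morphisms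
`Q → R` are the maps induced by conjugations `x ↦ g⁻¹ x g` in `G`. -/
def ofEmbedding {P : Type u} [Group P] {G : Type*} [Group G] (ι : P →* G)
    (hι : Function.Injective ι) : FusionSystem P where
  Hom Q R := {φ | ∃ g : G, ∀ x : Q, ι (φ x) = g⁻¹ * ι x * g}
  injective := by
    rintro Q R φ ⟨g, hg⟩ x y hxy
    have h := hg x
    rw [hxy, hg y] at h
    exact Subtype.ext (hι (by simpa using h.symm))
  id_mem Q := ⟨1, by simp⟩
  comp_mem := by
    rintro Q R T φ ψ ⟨g, hg⟩ ⟨k, hk⟩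
    exact ⟨g * k, fun x => by simp [hg, hk, mul_assoc]⟩
  conj_mem g φ h := ⟨ι g, fun x => by simp [h]⟩
  iso_mem := by
    rintro Q R S φ ⟨g, hg⟩ e he
    refine ⟨⟨g, fun x => by simp [he, hg]⟩, ⟨g⁻¹, fun y => ?_⟩⟩
    have h := hg (e.symm y)
    rw [← he] at h
    simp only [MulEquiv.apply_symm_apply] at h
    simp [h, mul_assoc]

/-- `F_P(G)`, the fusion system of the group `G` on its subgroup `P`. -/
def ofGroup {G : Type u} [Group G] (P : Subgroup G) : FusionSystem P :=
  ofEmbedding P.subtype P.subtype_injective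

variable {P : Type u} [Group P]

/-- The image of a homomorphism between subgroups of `P`, as a subgroup of `P`. -/
def image {Q R : Subgroup P} (φ : Q →* R) : Subgroup P := φ.range.map R.subtype

/-- `Q` is fully `F`-normalised. -/
def IsFullyNormalised (F : FusionSystem P) (Q : Subgroup P) : Prop :=
  ∀ (R : Subgroup P), ∀ φ ∈ F.Hom Q R,
    Nat.card (Subgroup.normalizer (image φ : Set P)) ≤ Nat.card (Subgroup.normalizer (Q : Set P))

/-- `Q` is `F`-centric. -/
def IsCentric (F : FusionSystem P) (Q : Subgroup P) : Prop :=
  ∀ (R : Subgroup P), ∀ φ ∈ F.Hom Q R,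
    Subgroup.centralizer (image φ : Set P) ≤ image φ

/-- For a subgroup `R` of `N_P(Q)`, the subgroup `RQ` of `P` (as `R` normalises `Q`, the join is
the product). -/
def mulNorm (Q : Subgroup P) (R : Subgroup (Subgroup.normalizer (Q : Set P))) : Subgroup P :=
  R.map (Subgroup.normalizer (Q : Set P)).subtype ⊔ Q

theorem mulNorm_left {Q : Subgroup P} {R : Subgroup (Subgroup.normalizer (Q : Set P))} (x : R) :
    ((x : Subgroup.normalizer (Q : Set P)) : P) ∈ mulNorm Q R :=
  Subgroup.mem_sup_left ⟨x, x.2, rfl⟩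

theorem mulNorm_right {Q : Subgroup P} {R : Subgroup (Subgroup.normalizer (Q : Set P))} (x : Q) :
    (x : P) ∈ mulNorm Q R :=
  Subgroup.mem_sup_right x.2

/-- `φ' : RQ → TQ` is a morphism of `F` which extends `φ : R → T` and restricts to an
`F`-automorphism of `Q`. (In particular `φ` is then itself a morphism of `F`.) -/
def IsExtension (F : FusionSystem P) (Q : Subgroup P)
    {R T : Subgroup (Subgroup.normalizer (Q : Set P))} (φ : R →* T)
    (φ' : mulNorm Q R →* mulNorm Q T) : Prop :=
  φ' ∈ F.Hom (mulNorm Q R) (mulNorm Q T) ∧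
  (∀ x : R, (φ' ⟨x, mulNorm_left x⟩ : P) = (φ x : Subgroup.normalizer (Q : Set P))) ∧
  ∃ α : Q ≃* Q, α.toMonoidHom ∈ F.Hom Q Q ∧
    ∀ x : Q, (φ' ⟨x, mulNorm_right x⟩ : P) = α x

theorem image_extension {F : FusionSystem P} {Q : Subgroup P}
    {R T S : Subgroup (Subgroup.normalizer (Q : Set P))} {φ : R →* T}
    {φ' : mulNorm Q R →* mulNorm Q T} (h : F.IsExtension Q φ φ') (e : R ≃* S)
    (he : ∀ x : R, (e x : Subgroup.normalizer (Q : Set P)) = φ x) :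
    image φ' = mulNorm Q S := by
  obtain ⟨-, h2, α, -, h4⟩ := h
  apply le_antisymm
  · have key : mulNorm Q R ≤
        ((mulNorm Q S).comap ((mulNorm Q T).subtype.comp φ')).map (mulNorm Q R).subtype := by
      refine sup_le ?_ ?_
      · rintro _ ⟨x, hx, rfl⟩
        refine ⟨⟨x, mulNorm_left ⟨x, hx⟩⟩, ?_, rfl⟩
        change (φ' ⟨x, mulNorm_left ⟨x, hx⟩⟩ : P) ∈ mulNorm Q S
        rw [h2 ⟨x, hx⟩, ← he]
        exact mulNorm_left _
      · intro x hx
        refine ⟨⟨x, mulNorm_right ⟨x, hx⟩⟩, ?_, rfl⟩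
        change (φ' ⟨x, mulNorm_right ⟨x, hx⟩⟩ : P) ∈ mulNorm Q S
        rw [h4 ⟨x, hx⟩]
        exact mulNorm_right _
    rintro _ ⟨_, ⟨x, rfl⟩, rfl⟩
    obtain ⟨y, hy, hxy⟩ := key x.2
    obtain rfl : y = x := Subtype.ext hxy
    exact hy
  · refine sup_le ?_ ?_
    · rintro _ ⟨y, hy, rfl⟩
      refine ⟨_, ⟨⟨_, mulNorm_left (e.symm ⟨y, hy⟩)⟩, rfl⟩, ?_⟩
      change (φ' _ : P) = _
      rw [h2, ← he]
      simp
    · intro y hy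
      refine ⟨_, ⟨⟨_, mulNorm_right (α.symm ⟨y, hy⟩)⟩, rfl⟩, ?_⟩
      change (φ' _ : P) = _
      rw [h4]
      simp

/-- The normaliser `N_F(Q)` of `Q` in `F`, a fusion system on `N_P(Q)`: its morphisms are the
`φ : R → T` which extend to a morphism `RQ → TQ` of `F` that restricts to an `F`-automorphism
of `Q`. -/
def normaliser (F : FusionSystem P) (Q : Subgroup P) :
    FusionSystem (Subgroup.normalizer (Q : Set P)) where
  Hom R T := {φ | ∃ φ', F.IsExtension Q φ φ'}
  injective := by
    rintro R T φ ⟨φ', h1, h2, -⟩ x y hxy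
    have h : φ' ⟨x, mulNorm_left x⟩ = φ' ⟨y, mulNorm_left y⟩ :=
      Subtype.ext (by rw [h2, h2, hxy])
    exact Subtype.ext (Subtype.ext (Subtype.mk.inj (F.injective h1 h)))
  id_mem R := ⟨MonoidHom.id _, F.id_mem _, fun x => rfl, MulEquiv.refl Q, F.id_mem Q, fun x => rfl⟩
  comp_mem := by
    rintro R T U φ ψ ⟨φ', h1, h2, α, h3, h4⟩ ⟨ψ', k1, k2, β, k3, k4⟩
    refine ⟨ψ'.comp φ', F.comp_mem h1 k1, fun x => ?_, α.trans β, F.comp_mem h3 k3, fun x => ?_⟩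
    · have : φ' ⟨x, mulNorm_left x⟩ = ⟨φ x, mulNorm_left (φ x)⟩ := Subtype.ext (h2 x)
      simp [this, k2]
    · have : φ' ⟨x, mulNorm_right x⟩ = ⟨α x, mulNorm_right (α x)⟩ := Subtype.ext (h4 x)
      simp [this, k4]
  conj_mem := by
    intro R T g φ h
    have hQ : ∀ x ∈ Q, (g : P)⁻¹ * x * g ∈ Q := fun x hx =>
      (Subgroup.mem_normalizer_iff''.1 g.2 x).1 hx
    have hQ' : ∀ x ∈ Q, (g : P) * x * (g : P)⁻¹ ∈ Q := fun x hx =>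
      (Subgroup.mem_normalizer_iff.1 g.2 x).1 hx
    have hle : mulNorm Q R ≤
        (mulNorm Q T).comap (MulAut.conj (g : P)⁻¹).toMonoidHom := by
      refine sup_le ?_ ?_
      · rintro _ ⟨x, hx, rfl⟩
        have := congrArg Subtype.val (h ⟨x, hx⟩)
        simp only [Subgroup.coe_mul, Subgroup.coe_inv] at this
        simpa [← this] using mulNorm_left (φ ⟨x, hx⟩)
      · intro x hx
        simpa using mulNorm_right (R := T) ⟨_, hQ x hx⟩
    refine ⟨((MulAut.conj (g : P)⁻¹).toMonoidHom.comp (mulNorm Q R).subtype).codRestrict _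
      (fun x => hle x.2), F.conj_mem (g : P) _ (fun x => by simp), fun x => by simp [h],
      ⟨⟨fun x => ⟨_, hQ x x.2⟩, fun x => ⟨_, hQ' x x.2⟩, fun x => ?_, fun x => ?_⟩, fun x y => ?_⟩,
      F.conj_mem (g : P) _ (fun x => rfl), fun x => by simp⟩
    · ext; simp [mul_assoc]
    · ext; simp [mul_assoc]
    · ext; simp [mul_assoc]
  iso_mem := by
    rintro R T S φ ⟨φ', h⟩ e he
    have he' : ∀ x : R, (e x : Subgroup.normalizer (Q : Set P)) = φ x := he
    have him := image_extension h e he'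
    obtain ⟨h1, h2, α, h3, h4⟩ := h
    have hinj : Function.Injective ((mulNorm Q T).subtype.comp φ') :=
      (Subgroup.subtype_injective _).comp (F.injective h1)
    have hrange : ((mulNorm Q T).subtype.comp φ').range = mulNorm Q S := by
      rw [← him, MonoidHom.range_comp]; rfl
    let E : mulNorm Q R ≃* mulNorm Q S :=
      (MonoidHom.ofInjective hinj).trans (MulEquiv.subgroupCongr hrange)
    have hE : ∀ x, (E x : P) = φ' x := fun x => rfl
    obtain ⟨m1, m2⟩ := F.iso_mem h1 E hE
    obtain ⟨a1, a2⟩ := F.iso_mem h3 α (fun x => rfl)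
    refine ⟨⟨E.toMonoidHom, m1, fun x => ?_, α, a1, fun x => ?_⟩,
      ⟨E.symm.toMonoidHom, m2, fun y => ?_, α.symm, a2, fun y => ?_⟩⟩
    · change (E _ : P) = _
      rw [hE, h2, ← he']; rfl
    · change (E _ : P) = _
      rw [hE, h4]
    · have : E ⟨_, mulNorm_left (e.symm y)⟩ = ⟨y, mulNorm_left y⟩ :=
        Subtype.ext (by rw [hE, h2, ← he']; simp)
      change (E.symm _ : P) = _
      rw [← this]; simp
    · have : E ⟨_, mulNorm_right (α.symm y)⟩ = ⟨y, mulNorm_right y⟩ :=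
        Subtype.ext (by rw [hE, h4]; simp)
      change (E.symm _ : P) = _
      rw [← this]; simp

/-- The finite group `L` is a model of the fusion system `F` on the `p`-group `P`: `L` is
`p`-constrained and `p'`-reduced, and `P` can be identified with a Sylow `p`-subgroup of `L` in
such a way that `F = F_P(L)`. -/
def IsModel (p : ℕ) (F : FusionSystem P) (L : Type*) [Group L] : Prop :=
  Subgroup.centralizer (pCore p L : Set L) ≤ pCore p L ∧
  pPrimeCore p L = ⊥ ∧
  ∃ (ι : P →* L) (hι : Function.Injective ι),
    (∃ S : Sylow p L, (S : Subgroup L) = ι.range) ∧ F = ofEmbedding ι hι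

/-- `F` is `Qd(p)`-free: `Qd(p)` is not involved in the models of the normalisers of the
`F`-centric fully `F`-normalised subgroups. -/
def IsQdFree (p : ℕ) (F : FusionSystem P) : Prop :=
  ∀ Q : Subgroup P, F.IsCentric Q → F.IsFullyNormalised Q →
    ∀ (L : Type u) [Group L] [Finite L], IsModel p (F.normaliser Q) L → ¬ Involves L (Qd p)

end FusionSystem

/-! Write N for N_G(Q). If Q is fully normalised, then N_P(Q) is a Sylow subgroup of N, and the
normaliser of Q in F is the fusion system of N on it (`normaliser_ofGroup`). Both directions compare
models with N.

If G does not involve Qd(p), neither does any model L, because L is a section of N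
(`involves_of_isModel`). Equality of the fusion systems makes Q normal in L with C_L(Q) ≤ Q. Let U ≤
L × N consist of the pairs inducing the same automorphism of Q. The pairs with both components in
the common Sylow subgroup S form a Sylow subgroup H of U, on which (l, s) ↦ l s⁻¹ is a crossed
homomorphism to the abelian p-group A = C_L(Q). Its transfer D to U is the |U : H|-th power map on A
× 1, hence bijective there; the kernel of D is the graph of a homomorphism from a subgroup of N onto
L (`involves_of_common_sylow`).

Conversely, let G involve Qd(p). A Frattini argument gives a p-subgroup T with a map f onto 𝔽_p²
such that the normaliser of T induces SL₂(p) through f. Adjoining a Sylow p-subgroup of C_G(T), and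
adjusting by another Frattini argument, yields Q containing all p-elements of its centraliser, with
N still inducing SL₂(p). After conjugation Q is centric and fully normalised in P, and N / O_{p'}(N)
is a model (`isModel_quotient_pPrimeCore`). The induced action survives in this quotient, and for
odd p it already forces a section Qd(p) (`involves_of_inducesSL2`): a 2-element lifting -1 ∈ SL₂(p)
inverts 𝔽_p², so the normaliser of a suitable 2-subgroup covers SL₂(p) and meets T only inside ker
f. -/

/-! ### Sections as graphs of homomorphisms. -/

/-- A section of `Γ` isomorphic to `X` is the same thing as a subgroup of `Γ × X` which is the graph
of a homomorphism from a subgroup of `Γ` onto `X`. -/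
theorem involves_iff {Γ X : Type*} [Group Γ] [Group X] :
    Involves Γ X ↔ ∃ W : Subgroup (Γ × X), (∀ x, ∃ g, (g, x) ∈ W) ∧ ∀ x, (1, x) ∈ W → x = 1 := by
  constructor
  · rintro ⟨H, K, hK, ⟨e⟩⟩
    refine ⟨((H.subtype).prod (e.toMonoidHom.comp (QuotientGroup.mk' K))).range, fun x => ?_, ?_⟩
    · obtain ⟨h, hh⟩ := QuotientGroup.mk'_surjective K (e.symm x)
      exact ⟨h, h, Prod.ext rfl ((congrArg e hh).trans (e.apply_symm_apply x))⟩
    · rintro x ⟨h, hh⟩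
      simp only [MonoidHom.prod_apply, Prod.mk.injEq] at hh
      have : h = 1 := Subtype.ext hh.1
      simpa [this] using hh.2.symm
  · rintro ⟨W, hs, h1⟩
    let a : W →* Γ := (MonoidHom.fst Γ X).comp W.subtype
    let b : W →* X := (MonoidHom.snd Γ X).comp W.subtype
    have ha : Function.Injective a := by
      rw [injective_iff_map_eq_one]
      rintro ⟨⟨g, x⟩, hw⟩ (h : g = 1)
      subst h
      have := h1 x hw
      subst this
      rfl
    let e : W ≃* a.range := MonoidHom.ofInjective ha
    let c : a.range →* X := b.comp e.symm.toMonoidHom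
    have hc : Function.Surjective c := fun x => by
      obtain ⟨g, hg⟩ := hs x
      exact ⟨e ⟨_, hg⟩, by simp [c, b]⟩
    exact ⟨a.range, c.ker, inferInstance, ⟨QuotientGroup.quotientKerEquivOfSurjective c hc⟩⟩

/-- The graphs compose as relations. -/
theorem Involves.trans {G L X : Type*} [Group G] [Group L] [Group X]
    (h : Involves G L) (h' : Involves L X) : Involves G X := by
  obtain ⟨V, hV, hV1⟩ := involves_iff.1 h
  obtain ⟨W, hW, hW1⟩ := involves_iff.1 h'
  refine involves_iff.2 ⟨⟨⟨⟨{y | ∃ l, (y.1, l) ∈ V ∧ (l, y.2) ∈ W}, ?_⟩, ?_⟩, ?_⟩, ?_, ?_⟩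
  · rintro _ _ ⟨l, h1, h2⟩ ⟨k, k1, k2⟩
    exact ⟨l * k, V.mul_mem h1 k1, W.mul_mem h2 k2⟩
  · exact ⟨1, V.one_mem, W.one_mem⟩
  · rintro _ ⟨l, h1, h2⟩
    exact ⟨l⁻¹, V.inv_mem h1, W.inv_mem h2⟩
  · intro x
    obtain ⟨l, hl⟩ := hW x
    obtain ⟨g, hg⟩ := hV l
    exact ⟨g, l, hg, hl⟩
  · rintro x ⟨l, h1, h2⟩
    have := hV1 l h1
    subst this
    exact hW1 x h2

theorem Involves.of_subgroup {G X : Type*} [Group G] [Group X] (N : Subgroup G)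
    (h : Involves N X) : Involves G X := by
  refine Involves.trans (involves_iff.2 ⟨(N.subtype.prod (MonoidHom.id N)).range, ?_, ?_⟩) h
  · exact fun n => ⟨n, n, rfl⟩
  · rintro x ⟨n, hn⟩
    simp only [MonoidHom.prod_apply, Prod.mk.injEq] at hn
    exact hn.2.symm.trans (Subtype.ext hn.1)

/-! ### Transfer of crossed homomorphisms. -/

/-- Corestriction of a crossed homomorphism from a subgroup of finite index. -/
theorem exists_crossedHom_corestrict {U Z : Type*} [Group U] [CommGroup Z] (φ : U →* MulAut Z)
    (H : Subgroup U) [H.FiniteIndex] (α : H → Z)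
    (hα : ∀ h k : H, α (h * k) = α h * φ h (α k)) :
    ∃ D : U → Z, (∀ g h, D (g * h) = D g * φ g (D h)) ∧
      ∀ (a : U) (z : Z), (∀ t : U, ∃ h : t⁻¹ * a * t ∈ H, φ t (α ⟨_, h⟩) = z) →
        D a = z ^ H.index := by
  classical
  let := H.fintypeQuotientOfFiniteIndex
  have hmem : ∀ (g : U) (q : U ⧸ H), q.out⁻¹ * g * (g⁻¹ • q).out ∈ H := fun g q => by
    rw [mul_assoc, ← QuotientGroup.eq, QuotientGroup.out_eq', ← smul_eq_mul (a := g),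
      ← MulAction.Quotient.smul_coe, QuotientGroup.out_eq', smul_inv_smul]
  -- The transfer formula over the coset representatives `q.out`, each factor twisted by the action
  -- of its representative.
  refine ⟨fun g => ∏ q : U ⧸ H, φ q.out (α ⟨_, hmem g q⟩), fun g h => ?_, fun a z hz => ?_⟩
  · rw [map_prod, ← Equiv.prod_comp (MulAction.toPerm g⁻¹)
      (fun q : U ⧸ H => φ g (φ q.out (α ⟨_, hmem h q⟩))), ← Finset.prod_mul_distrib]
    refine Finset.prod_congr rfl fun q _ => ?_
    have e : (⟨_, hmem (g * h) q⟩ : H) = ⟨_, hmem g q⟩ * ⟨_, hmem h (g⁻¹ • q)⟩ := by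
      ext
      simp [mul_assoc, mul_smul]
    rw [e, hα, map_mul, ← MulAut.mul_apply, ← MulAut.mul_apply, ← map_mul, ← map_mul]
    simp [mul_assoc]
  · rw [Subgroup.index_eq_card, Nat.card_eq_fintype_card, ← Finset.card_univ, ← Finset.prod_const]
    refine Finset.prod_congr rfl fun q _ => ?_
    obtain ⟨h, e⟩ := hz q.out
    -- The hypothesis at t = `q.out` says that `a` fixes the coset `q`, so both representatives in
    -- the factor agree and the factor is `z`.
    have hq : a⁻¹ • q = q := by
      rw [inv_smul_eq_iff]
      conv_lhs => rw [← QuotientGroup.out_eq' q]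
      conv_rhs => rw [← QuotientGroup.out_eq' q]
      rw [MulAction.Quotient.smul_coe, QuotientGroup.eq, smul_eq_mul, ← mul_assoc]
      exact h
    rw [← e]
    congr 3
    rw [hq]

/-! ### The subgroups O_p and O_{p'}. -/

section Cores

variable {p : ℕ} {L : Type*} [Group L]

instance pCore_normal : (pCore p L).Normal := Subgroup.sSup_normal _ fun _ h => h.1

instance pPrimeCore_normal : (pPrimeCore p L).Normal := Subgroup.sSup_normal _ fun _ h => h.1

theorem pCore_le_sylow (S : Sylow p L) : pCore p L ≤ S := by
  refine sSup_le fun N hN => ?_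
  have := hN.1
  exact hN.2.le_sylow_of_normal S

theorem le_pCore {N : Subgroup L} (hN : N.Normal) (h : IsPGroup p N) : N ≤ pCore p L :=
  le_sSup ⟨hN, h⟩

theorem le_pPrimeCore {N : Subgroup L} (hN : N.Normal) (h : (Nat.card N).Coprime p) :
    N ≤ pPrimeCore p L :=
  le_sSup ⟨hN, h⟩

/-- `IsPGroup m` makes sense for composite m. With m the p'-part of |L|, each normal p'-subgroup
satisfies it, hence so does their join; an element of order p cannot. -/
theorem coprime_card_pPrimeCore [Fact p.Prime] [Finite L] : (Nat.card (pPrimeCore p L)).Coprime p := by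
  have hp : p.Prime := Fact.out
  have hm : (ordCompl[p] (Nat.card L)).Coprime p :=
    (Nat.coprime_ordCompl hp Nat.card_pos.ne').symm
  have h : IsPGroup (ordCompl[p] (Nat.card L)) (pPrimeCore p L) := by
    refine Sylow.sSup_of_normal _ (fun N hN => ?_) fun N hN => hN.1
    refine IsPGroup.of_card_dvd_pow (n := 1) ?_
    rw [pow_one]
    refine Nat.Coprime.dvd_of_dvd_mul_left (hN.2.pow_right ((Nat.card L).factorization p)) ?_
    rw [Nat.ordProj_mul_ordCompl_eq_self]
    exact Subgroup.card_subgroup_dvd_card N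
  rw [Nat.coprime_comm, hp.coprime_iff_not_dvd]
  intro hd
  obtain ⟨x, hx⟩ := exists_prime_orderOf_dvd_card' p hd
  have := h.orderOf_coprime hm x
  rw [hx, Nat.coprime_self] at this
  exact hp.one_lt.ne' this

theorem IsPGroup.eq_one_of_coprime {A : Subgroup L} (hA : IsPGroup p A) {B : Subgroup L}
    (hB : (Nat.card B).Coprime p) {x : L} (hxA : x ∈ A) (hxB : x ∈ B) : x = 1 := by
  obtain ⟨k, hk⟩ := hA ⟨x, hxA⟩
  have h1 : orderOf x ∣ p ^ k := orderOf_dvd_of_pow_eq_one (by simpa using congrArg Subtype.val hk)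
  have h2 : orderOf x ∣ Nat.card B := by
    simpa using orderOf_dvd_natCard (⟨x, hxB⟩ : B)
  exact orderOf_eq_one_iff.1 (Nat.eq_one_of_dvd_coprimes (hB.pow_right k) h2 h1)

/-- If `Q` is a normal subgroup containing all `p`-elements of its centraliser, then this
centraliser is generated by `Z(Q)` and a normal subgroup of order prime to `p`. -/
theorem centralizer_le_sup_pPrimeCore [Fact p.Prime] [Finite L] (Q : Subgroup L) [Q.Normal]
    (hQ : ∀ x ∈ Subgroup.centralizer (Q : Set L), (∃ k, x ^ p ^ k = 1) → x ∈ Q) :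
    Subgroup.centralizer (Q : Set L) ≤ Q ⊔ pPrimeCore p L := by
  have hp : p.Prime := Fact.out
  have hCn : (Subgroup.centralizer (Q : Set L)).Normal := Subgroup.normal_centralizer
  generalize hC : Subgroup.centralizer (Q : Set L) = C at *
  have hcomm : ∀ c ∈ C, ∀ q ∈ Q, q * c = c * q := by
    subst hC
    exact fun c hc q hq => Subgroup.mem_centralizer_iff.1 hc q hq
  let S : Sylow p C := default
  have hSQ : ∀ x ∈ (S : Subgroup C), (x : L) ∈ Q := fun x hx => by
    obtain ⟨k, hk⟩ := S.2 ⟨x, hx⟩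
    refine hQ x x.2 ⟨k, ?_⟩
    exact congrArg (fun y : (S : Subgroup C) => ((y : C) : L)) hk
  -- The Sylow subgroup `S` of `C` lies in `Q`, so it is central in `C` and Burnside's transfer
  -- theorem supplies a normal p-complement.
  have hS : Subgroup.normalizer (S : Set C) ≤ Subgroup.centralizer (S : Set C) := by
    intro c _
    rw [Subgroup.mem_centralizer_iff]
    exact fun x hx => Subtype.ext (hcomm c c.2 x (hSQ x hx))
  let τ := MonoidHom.transferSylow S hS
  have hτ : ¬ p ∣ Nat.card τ.ker := MonoidHom.not_dvd_card_ker_transferSylow S hS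
  have hcompl := (MonoidHom.ker_transferSylow_isComplement' S hS).sup_eq_top
  -- The complement consists exactly of the p'-elements of `C`, which makes it normal in `L`.
  have hker : ∀ c : C, c ∈ τ.ker ↔ ¬ p ∣ orderOf c := by
    refine fun c => ⟨fun hc hd => hτ (hd.trans ?_), fun hc => ?_⟩
    · simpa using orderOf_dvd_natCard (⟨c, hc⟩ : τ.ker)
    · obtain ⟨k, hk⟩ := S.2 (τ c)
      have h1 : orderOf (τ c) ∣ p ^ k := orderOf_dvd_of_pow_eq_one hk
      have h2 : orderOf (τ c) ∣ orderOf c := orderOf_map_dvd τ c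
      exact orderOf_eq_one_iff.1 (Nat.eq_one_of_dvd_coprimes
        (((hp.coprime_iff_not_dvd.2 hc).symm).pow_right k) h2 h1)
  have hK : (τ.ker.map C.subtype).Normal := by
    refine ⟨?_⟩
    rintro _ ⟨c, hc, rfl⟩ g
    refine ⟨⟨g * c * g⁻¹, hCn.conj_mem c c.2 g⟩, (hker _).2 ?_, rfl⟩
    have := (hker c).1 hc
    rw [← Subgroup.orderOf_coe] at this ⊢
    change ¬ p ∣ orderOf (MulAut.conj g (c : L))
    rwa [MulEquiv.orderOf_eq]
  have hle : τ.ker.map C.subtype ≤ pPrimeCore p L := by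
    refine le_pPrimeCore hK ?_
    rw [Subgroup.card_map_of_injective C.subtype_injective, Nat.coprime_comm,
      hp.coprime_iff_not_dvd]
    exact hτ
  intro c hc
  have : (⟨c, hc⟩ : C) ∈ τ.ker ⊔ (S : Subgroup C) := by rw [hcompl]; trivial
  obtain ⟨k, hk, s, hs, e⟩ := Subgroup.mem_sup_of_normal_left.1 this
  have e' : (k : L) * s = c := congrArg Subtype.val e
  rw [← e']
  exact mul_mem (Subgroup.mem_sup_right (hle ⟨k, hk, rfl⟩)) (Subgroup.mem_sup_left (hSQ s hs))

end Cores

/-! ### Two groups with a common Sylow subgroup and the same action on Q. -/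

section Embeddings

variable {p : ℕ} [Fact p.Prime] {S : Type u} {L N : Type*} [Group S] [Group L] [Group N]

/-- Let `Q ≤ S` be normalised by two groups `L` and `N` with common Sylow `p`-subgroup `S`, such that
`C_L(Q) ≤ Q` and every automorphism of `Q` induced by `L` is induced by `N`. Then `L` is a section
of `N`. -/
theorem involves_of_common_sylow [Finite L] [Finite N] {ι : S →* L} {κ : S →* N}
    (hι : Function.Injective ι) (hκ : Function.Injective κ)
    (SL : Sylow p L) (hSL : (SL : Subgroup L) = ι.range)
    (SN : Sylow p N) (hSN : (SN : Subgroup N) = κ.range)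
    (Q : Subgroup S) (hQL : (Q.map ι).Normal)
    (hc : Subgroup.centralizer (Q.map ι : Set L) ≤ Q.map ι)
    (hact : ∀ l : L, ∃ n : N, ∀ q ∈ Q, ∃ q' ∈ Q, ι q' = l * ι q * l⁻¹ ∧ κ q' = n * κ q * n⁻¹) :
    Involves N L := by
  have hAn : (Subgroup.centralizer (Q.map ι : Set L)).Normal := Subgroup.normal_centralizer
  generalize hA : Subgroup.centralizer (Q.map ι : Set L) = A at *
  have hcomm : ∀ a ∈ A, ∀ q ∈ Q, ι q * a = a * ι q := by
    subst hA
    exact fun a ha q hq => Subgroup.mem_centralizer_iff.1 ha _ ⟨q, hq, rfl⟩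
  have hmemA : ∀ l : L, (∀ q ∈ Q, ι q * l = l * ι q) → l ∈ A := by
    subst hA
    rintro l hl
    rw [Subgroup.mem_centralizer_iff]
    rintro _ ⟨q, hq, rfl⟩
    exact hl q hq
  let : CommGroup A :=
    { (inferInstance : Group A) with
      mul_comm := fun a b => Subtype.ext (by
        obtain ⟨q, hq, e⟩ := hc a.2
        change (a : L) * b = b * a
        rw [← e]
        exact hcomm b b.2 q hq) }
  have hQn : ∀ s : S, ∀ q ∈ Q, s * q * s⁻¹ ∈ Q := by
    intro s q hq
    obtain ⟨q', hq', e⟩ := hQL.conj_mem _ ⟨q, hq, rfl⟩ (ι s)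
    rw [← map_inv, ← map_mul, ← map_mul] at e
    exact hι e ▸ hq'
  let U : Subgroup (L × N) :=
    { carrier := {u | ∀ q ∈ Q, ∃ q' ∈ Q, ι q' = u.1 * ι q * u.1⁻¹ ∧ κ q' = u.2 * κ q * u.2⁻¹}
      one_mem' := fun q hq => ⟨q, hq, by simp⟩
      mul_mem' := by
        intro u v hu hv q hq
        obtain ⟨q₁, h₁, e₁, f₁⟩ := hv q hq
        obtain ⟨q₂, h₂, e₂, f₂⟩ := hu q₁ h₁
        exact ⟨q₂, h₂, by simp [e₂, e₁, mul_assoc], by simp [f₂, f₁, mul_assoc]⟩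
      inv_mem' := by
        intro u hu q hq
        obtain ⟨q₁, h₁, e₁⟩ := hQL.conj_mem _ ⟨q, hq, rfl⟩ u.1⁻¹
        obtain ⟨q₂, h₂, e₂, f₂⟩ := hu q₁ h₁
        have : q₂ = q := hι (by rw [e₂, e₁]; group)
        subst this
        exact ⟨q₁, h₁, e₁, by simp [f₂, mul_assoc]⟩ }
  have hdiag : ∀ s : S, (ι s, κ s) ∈ U := fun s q hq => ⟨_, hQn s q hq, by simp, by simp⟩
  let a : U →* L := (MonoidHom.fst L N).comp U.subtype
  let b : U →* N := (MonoidHom.snd L N).comp U.subtype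
  let H : Subgroup U := (ι.range.comap a) ⊓ (κ.range.comap b)
  have hHp : IsPGroup p H := by
    rintro ⟨⟨⟨l, n⟩, hu⟩, h1, h2⟩
    obtain ⟨i, hi⟩ := SL.2 ⟨l, hSL ▸ h1⟩
    obtain ⟨j, hj⟩ := SN.2 ⟨n, hSN ▸ h2⟩
    have hi' : l ^ p ^ i = 1 := congrArg Subtype.val hi
    have hj' : n ^ p ^ j = 1 := congrArg Subtype.val hj
    refine ⟨i + j, Subtype.ext (Subtype.ext (Prod.ext ?_ ?_))⟩
    · change l ^ p ^ (i + j) = 1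
      rw [pow_add, pow_mul, hi', one_pow]
    · change n ^ p ^ (i + j) = 1
      rw [add_comm, pow_add, pow_mul, hj', one_pow]
  obtain ⟨T, hT⟩ := hHp.exists_le_sylow
  -- Each projection of a Sylow subgroup containing `H` is a p-group containing the Sylow subgroup
  -- `S` of that factor, hence equals it.
  have hTH : (T : Subgroup U) = H := by
    refine le_antisymm (le_inf ?_ ?_) hT
    · rw [← hSL, ← Subgroup.map_le_iff_le_comap]
      refine (SL.3 (T.2.map a) ?_).le
      rw [hSL]
      rintro _ ⟨s, rfl⟩
      exact ⟨⟨_, hdiag s⟩, hT ⟨⟨s, rfl⟩, ⟨s, rfl⟩⟩, rfl⟩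
    · rw [← hSN, ← Subgroup.map_le_iff_le_comap]
      refine (SN.3 (T.2.map b) ?_).le
      rw [hSN]
      rintro _ ⟨s, rfl⟩
      exact ⟨⟨_, hdiag s⟩, hT ⟨⟨s, rfl⟩, ⟨s, rfl⟩⟩, rfl⟩
  have hidx : p.Coprime H.index := by
    rw [(Fact.out : p.Prime).coprime_iff_not_dvd, ← hTH]
    exact T.not_dvd_index
  have hAp : IsPGroup p A := by
    refine SL.2.to_le (hc.trans ?_)
    rw [hSL]
    rintro _ ⟨q, -, rfl⟩
    exact ⟨q, rfl⟩
  let e : S ≃* κ.range := MonoidHom.ofInjective hκ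
  have he : ∀ x : κ.range, κ (e.symm x) = x := fun x =>
    congrArg Subtype.val (e.apply_symm_apply x)
  let ν : H →* S := e.symm.toMonoidHom.comp
    ((b.comp H.subtype).codRestrict κ.range fun h => h.2.2)
  have hν : ∀ h : H, κ (ν h) = (h : U).1.2 := fun h => he _
  -- In a pair of `H`, both components act alike on `Q`, so they differ by an element of `A` once
  -- both are read in `L`. This difference is the crossed homomorphism.
  have hαmem : ∀ h : H, (h : U).1.1 * (ι (ν h))⁻¹ ∈ A := by
    intro h
    obtain ⟨s, hs⟩ := h.2.1
    change ι s = (h : U).1.1 at hs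
    refine hmemA _ fun q hq => ?_
    have hq1 : (ν h)⁻¹ * q * ν h ∈ Q := by simpa using hQn (ν h)⁻¹ q hq
    obtain ⟨q', hq', e1, e2⟩ := (h : U).2 _ hq1
    have : q' = q := hκ (by rw [e2, ← hν]; simp [mul_assoc])
    subst this
    conv_lhs => rw [e1]
    simp [mul_assoc]
  let φ : U →* MulAut A := MulAut.conjNormal.comp a
  have hφ : ∀ (u : U) (x : A), (φ u x : L) = u.1.1 * x * u.1.1⁻¹ := fun u x => rfl
  obtain ⟨D, hD, hDpow⟩ := exists_crossedHom_corestrict φ H (fun h => ⟨_, hαmem h⟩) (by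
    intro h k
    rw [mul_comm]
    refine Subtype.ext ?_
    change (h : U).1.1 * (k : U).1.1 * (ι (ν (h * k)))⁻¹ =
      ((h : U).1.1 * ((k : U).1.1 * (ι (ν k))⁻¹) * (h : U).1.1⁻¹) * ((h : U).1.1 * (ι (ν h))⁻¹)
    simp [mul_assoc])
  have hD1 : D 1 = 1 := by
    have := hD 1 1
    simpa using this
  -- On A × 1 the crossed homomorphism is the equivariant inclusion, so its transfer is a power map;
  -- `hDN` is the same computation on 1 × Z(Q), with an inverse.
  have hDL : ∀ (l : L) (hu : ((l, 1) : L × N) ∈ U) (hl : l ∈ A),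
      D ⟨(l, 1), hu⟩ = (⟨l, hl⟩ : A) ^ H.index := by
    intro l hu hl
    refine hDpow _ _ fun t => ?_
    have h1 : t.1.1⁻¹ * l * t.1.1 ∈ A := by simpa using hAn.conj_mem l hl t.1.1⁻¹
    have hH : t⁻¹ * ⟨(l, 1), hu⟩ * t ∈ H := by
      refine ⟨?_, ?_⟩
      · obtain ⟨q, -, h⟩ := hc h1
        exact ⟨q, h⟩
      · exact ⟨1, by simp [b]⟩
    refine ⟨hH, Subtype.ext ?_⟩
    have h2 : ν ⟨_, hH⟩ = 1 := hκ (by rw [hν]; simp)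
    change t.1.1 * ((t.1.1⁻¹ * l * t.1.1) * (ι (ν ⟨_, hH⟩))⁻¹) * t.1.1⁻¹ = l
    rw [h2]
    simp [mul_assoc]
  have hDN : ∀ (q : S) (hu : ((1, κ q) : L × N) ∈ U) (_ : q ∈ Q) (hl : ι q ∈ A),
      D ⟨(1, κ q), hu⟩ = (⟨ι q, hl⟩⁻¹ : A) ^ H.index := by
    intro q hu hq hl
    refine hDpow _ _ fun t => ?_
    obtain ⟨q', hq', e1, e2⟩ := (t⁻¹).2 q hq
    have e1' : ι q' = t.1.1⁻¹ * ι q * t.1.1 := by simpa using e1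
    have e2' : κ q' = t.1.2⁻¹ * κ q * t.1.2 := by simpa using e2
    have hH : t⁻¹ * ⟨(1, κ q), hu⟩ * t ∈ H := by
      refine ⟨⟨1, by simp [a]⟩, ⟨q', ?_⟩⟩
      rw [e2']; rfl
    refine ⟨hH, Subtype.ext ?_⟩
    have h2 : ν ⟨_, hH⟩ = q' := hκ (by rw [hν, e2']; rfl)
    change t.1.1 * ((t.1.1⁻¹ * 1 * t.1.1) * (ι (ν ⟨_, hH⟩))⁻¹) * t.1.1⁻¹ = (ι q)⁻¹
    rw [h2, e1']
    simp [mul_assoc]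
  -- The graph is the kernel of `D`, with the two factors exchanged.
  refine involves_iff.2 ⟨⟨⟨⟨{w | ∃ h : (w.2, w.1) ∈ U, D ⟨_, h⟩ = 1}, ?_⟩, ?_⟩, ?_⟩, ?_, ?_⟩
  · rintro w v ⟨h1, h2⟩ ⟨k1, k2⟩
    refine ⟨U.mul_mem h1 k1, ?_⟩
    have := hD ⟨_, h1⟩ ⟨_, k1⟩
    rw [h2, k2, map_one, mul_one] at this
    exact this
  · exact ⟨U.one_mem, hD1⟩
  · rintro w ⟨h1, h2⟩
    refine ⟨U.inv_mem h1, ?_⟩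
    have := hD ⟨_, h1⟩ ⟨_, h1⟩⁻¹
    rw [mul_inv_cancel, hD1, h2, one_mul] at this
    exact (EmbeddingLike.map_eq_one_iff (f := φ ⟨_, h1⟩)).1 this.symm
  · intro l
    obtain ⟨n, hn⟩ := hact l
    have hu : (l, n) ∈ U := hn
    -- The index of `H` is prime to p, so `D (l, n)` has an index-th root in `A`; multiplying `n` by
    -- the corresponding element of Z(Q) cancels it.
    obtain ⟨x, hx⟩ := (hAp.powEquiv hidx).surjective (D ⟨_, hu⟩)
    rw [hAp.powEquiv_apply] at hx
    obtain ⟨q, hq, hqx⟩ := hc x.2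
    have hqA : ι q ∈ A := hqx ▸ x.2
    have hu' : ((1, κ q) : L × N) ∈ U := by
      intro r hr
      refine ⟨r, hr, by simp, ?_⟩
      have : ι (q * r) = ι (r * q) := by simp [hcomm _ hqA r hr]
      rw [eq_mul_inv_iff_mul_eq, ← map_mul, ← map_mul, hι this]
    have hxq : x = ⟨ι q, hqA⟩ := Subtype.ext hqx.symm
    refine ⟨κ q * n, ?_, ?_⟩
    · simpa using U.mul_mem hu' hu
    · have := hD ⟨_, hu'⟩ ⟨_, hu⟩
      have h1 : φ ⟨_, hu'⟩ (D ⟨_, hu⟩) = D ⟨_, hu⟩ := Subtype.ext (by rw [hφ]; simp)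
      rw [hDN q hu' hq hqA, h1, ← hx, hxq, inv_pow, inv_mul_cancel] at this
      rw [← this]
      congr 2
      simp
  · rintro l ⟨h1, h2⟩
    have hl : l ∈ A := by
      refine hmemA l fun q hq => ?_
      obtain ⟨q', hq', e1, e2⟩ := h1 q hq
      have : q' = q := hκ (by simpa using e2)
      subst this
      exact (eq_mul_inv_iff_mul_eq.1 e1)
    rw [hDL l h1 hl] at h2
    have := (hAp.powEquiv hidx).injective
      (a₁ := ⟨l, hl⟩) (a₂ := 1) (by rw [hAp.powEquiv_apply, hAp.powEquiv_apply, h2, one_pow])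
    exact congrArg Subtype.val this

end Embeddings

/-! ### A constrained group is determined up to section by its fusion system. -/

open Subgroup

theorem IsPGroup.exists_conj_mem_sylow {p : ℕ} [Fact p.Prime] {G : Type*} [Group G] [Finite G]
    {X : Subgroup G} (hX : IsPGroup p X) (P : Sylow p G) :
    ∃ g : G, ∀ x ∈ X, g * x * g⁻¹ ∈ (P : Subgroup G) := by
  obtain ⟨P', hP'⟩ := hX.exists_le_sylow
  obtain ⟨g, rfl⟩ := MulAction.exists_smul_eq G P' P
  refine ⟨g, fun x hx => ?_⟩
  rw [Sylow.coe_subgroup_smul]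
  exact smul_mem_pointwise_smul _ (MulAut.conj g) _ (hP' hx)

/-- Conjugation by `g`, as a homomorphism between subgroups of an embedded group. -/
theorem exists_conj_hom {P G : Type*} [Group P] [Group G] {ι : P →* G}
    (hι : Function.Injective ι) {R T : Subgroup P} (g : G)
    (h : ∀ x ∈ R, ∃ y ∈ T, ι y = g⁻¹ * ι x * g) :
    ∃ φ : R →* T, ∀ x : R, ι (φ x) = g⁻¹ * ι x * g := by
  choose f hf e using h
  exact ⟨MonoidHom.mk' (fun x => ⟨f x x.2, hf x x.2⟩) fun x y => Subtype.ext (hι (by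
    simp [e, mul_assoc])), fun x => e x x.2⟩

namespace FusionSystem

/-- The form in which equality of fusion systems is used: conjugations carrying a subgroup of S into
S can be moved between `L` and `N`. The codomain `⊤` puts no condition on the image within S. -/
theorem exists_conj_of_ofEmbedding_eq {S : Type u} {L N : Type*} [Group S] [Group L] [Group N]
    {ι : S →* L} {κ : S →* N} {hι : Function.Injective ι} {hκ : Function.Injective κ}
    (hF : ofEmbedding ι hι = ofEmbedding κ hκ) (R : Subgroup S) (l : L)
    (h : ∀ x ∈ R, ∃ y, ι y = l⁻¹ * ι x * l) :
    ∃ n : N, ∀ x ∈ R, ∀ y, ι y = l⁻¹ * ι x * l → κ y = n⁻¹ * κ x * n := by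
  obtain ⟨φ, hφ⟩ := exists_conj_hom hι (T := ⊤) l fun x hx => by simpa using h x hx
  have : φ ∈ (ofEmbedding ι hι).Hom R ⊤ := ⟨l, hφ⟩
  rw [hF] at this
  obtain ⟨n, hn⟩ := this
  refine ⟨n, fun x hx y hy => ?_⟩
  rw [← hn ⟨x, hx⟩]
  congr 1
  exact hι (hy.trans (hφ ⟨x, hx⟩).symm)

/-- If `L` is `p`-constrained, `p'`-reduced, and has the same fusion system as a group `N` with a
normal subgroup `Q` that is centric in the Sylow subgroup, then `L` is a section of `N`. -/
theorem involves_of_ofEmbedding_eq {p : ℕ} [Fact p.Prime] {S : Type u} {L N : Type*}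
    [Group S] [Group L] [Group N] [Finite L] [Finite N] {ι : S →* L} {κ : S →* N}
    (hι : Function.Injective ι) (hκ : Function.Injective κ)
    (SL : Sylow p L) (hSL : (SL : Subgroup L) = ι.range)
    (SN : Sylow p N) (hSN : (SN : Subgroup N) = κ.range)
    (Q : Subgroup S) (hQN : (Q.map κ).Normal) (hcen : centralizer (Q : Set S) ≤ Q)
    (hL : centralizer (pCore p L : Set L) ≤ pCore p L) (hL' : pPrimeCore p L = ⊥)
    (hF : ofEmbedding ι hι = ofEmbedding κ hκ) : Involves N L := by
  have hcore : pCore p L ≤ ι.range := hSL ▸ pCore_le_sylow SL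
  have hQN' : ∀ (n : N), ∀ q ∈ Q, ∃ y ∈ Q, κ y = n⁻¹ * κ q * n := fun n q hq => by
    simpa using hQN.conj_mem _ ⟨q, hq, rfl⟩ n⁻¹
  have hQS : ∀ s : S, ∀ q ∈ Q, s⁻¹ * q * s ∈ Q := fun s q hq => by
    obtain ⟨y, hy, e⟩ := hQN' (κ s) q hq
    rw [← map_inv, ← map_mul, ← map_mul] at e
    exact hκ e ▸ hy
  have hkey : ∀ (l : L), ∀ q ∈ Q, ∃ y ∈ Q, ι y = l⁻¹ * ι q * l := by
    intro l q hq
    have hR : ∀ x ∈ (pCore p L).comap ι, ∃ y, ι y = l⁻¹ * ι x * l := fun x hx =>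
      hcore (by simpa using (pCore_normal (p := p)).conj_mem (ι x) hx l⁻¹)
    -- Move `l` to `n` along R = O_p(L). Since `n` normalises `Q`, it carries all of RQ into S and
    -- can be moved back to some `m` in `L` along RQ.
    obtain ⟨n, hn⟩ := exists_conj_of_ofEmbedding_eq hF _ l hR
    have hRQ : (pCore p L).comap ι ⊔ Q ≤
        κ.range.comap ((MulAut.conj n⁻¹).toMonoidHom.comp κ) := by
      refine sup_le (fun x hx => ?_) fun x hx => ?_
      · obtain ⟨y, hy⟩ := hR x hx
        exact ⟨y, by simp [hn x hx y hy]⟩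
      · obtain ⟨y, -, hy⟩ := hQN' n x hx
        exact ⟨y, by simp [hy]⟩
    obtain ⟨m, hm⟩ := exists_conj_of_ofEmbedding_eq hF.symm _ n fun x hx => by
      obtain ⟨y, hy⟩ := hRQ hx
      exact ⟨y, by simpa using hy⟩
    -- Now `l` and `m` agree on O_p(L), so constraint gives l = s m with s ∈ O_p(L) ≤ S. Both `s`
    -- and `m` normalise `Q`, the latter because it acts there as `n`.
    have hc : l * m⁻¹ ∈ pCore p L := by
      refine hL (mem_centralizer_iff.2 fun x hx => ?_)
      obtain ⟨x, rfl⟩ := hcore hx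
      obtain ⟨y, hy⟩ := hR x hx
      have h1 := hm x (mem_sup_left hx) y (hn x hx y hy)
      rw [hy] at h1
      calc ι x * (l * m⁻¹) = l * (l⁻¹ * ι x * l) * m⁻¹ := by group
        _ = l * m⁻¹ * ι x := by rw [h1]; group
    obtain ⟨s, hs⟩ := hcore hc
    obtain ⟨y, hy, e⟩ := hQN' n _ (hQS s q hq)
    refine ⟨y, hy, ?_⟩
    rw [hm _ (mem_sup_right (hQS s q hq)) y e]
    have : l = ι s * m := by rw [hs]; group
    rw [this]
    simp [mul_assoc]
  have hQL : (Q.map ι).Normal := by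
    refine ⟨?_⟩
    rintro _ ⟨q, hq, rfl⟩ l
    simpa using hkey l⁻¹ q hq
  have hc : centralizer (Q.map ι : Set L) ≤ Q.map ι := by
    have hCn : (centralizer (Q.map ι : Set L)).Normal := normal_centralizer
    -- A p-element centralising `Q` has a conjugate in S, which lies in `Q` as `Q` is centric in S.
    -- So C_L(Q) ≤ Q O_{p'}(L), and O_{p'}(L) is trivial.
    have := centralizer_le_sup_pPrimeCore (p := p) (Q.map ι) (by
      rintro x hx ⟨k, hk⟩
      have hxp : IsPGroup p (zpowers x) := by
        refine IsPGroup.of_card_dvd_pow (n := k) ?_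
        rw [Nat.card_zpowers]
        exact orderOf_dvd_of_pow_eq_one hk
      obtain ⟨g, hg⟩ := hxp.exists_conj_mem_sylow SL
      have h1 : g * x * g⁻¹ ∈ (SL : Subgroup L) := hg x (mem_zpowers x)
      rw [hSL] at h1
      obtain ⟨s, hs⟩ := h1
      have h2 : g * x * g⁻¹ ∈ centralizer (Q.map ι : Set L) := hCn.conj_mem x hx g
      have h3 : s ∈ Q := by
        refine hcen (mem_centralizer_iff.2 fun q hq => hι ?_)
        rw [map_mul, map_mul, hs]
        exact mem_centralizer_iff.1 h2 _ ⟨q, hq, rfl⟩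
      have h4 := hQL.conj_mem _ ⟨s, h3, rfl⟩ g⁻¹
      rw [hs] at h4
      simpa [mul_assoc] using h4)
    rwa [hL', sup_bot_eq] at this
  refine involves_of_common_sylow hι hκ SL hSL SN hSN Q hQL hc fun l => ?_
  obtain ⟨n, hn⟩ := exists_conj_of_ofEmbedding_eq hF Q l⁻¹ fun q hq =>
    (hkey l⁻¹ q hq).imp fun _ h => h.2
  refine ⟨n⁻¹, fun q hq => ?_⟩
  obtain ⟨y, hy, e⟩ := hkey l⁻¹ q hq
  exact ⟨y, hy, by simpa using e, by simpa using hn q hq y e⟩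

/-! ### The normaliser fusion system is that of N_G(Q). -/

section Normalizer

variable {G : Type u} [Group G] (P : Subgroup G) (Q : Subgroup P)

/-- The embedding of `N_P(Q)` into `N_G(Q)`. -/
def normalizerEmbedding :
    normalizer (Q : Set P) →* normalizer ((Q.map P.subtype : Subgroup G) : Set G) :=
  (P.subtype.comp (normalizer (Q : Set P)).subtype).codRestrict _ fun x =>
    le_normalizer_map (H := Q) P.subtype ⟨x, x.2, rfl⟩

theorem normalizerEmbedding_injective : Function.Injective (normalizerEmbedding P Q) :=
  fun _ _ h => Subtype.ext (Subtype.ext (congrArg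
    (fun z : normalizer ((Q.map P.subtype : Subgroup G) : Set G) => (z : G)) h))

theorem mem_image_iff {P : Subgroup G} {Q R : Subgroup P} {φ : Q →* R} {g : G}
    (hφ : ∀ x : Q, P.subtype (φ x) = g⁻¹ * P.subtype x * g) (y : P) :
    y ∈ image φ ↔ g * (y : G) * g⁻¹ ∈ Q.map P.subtype := by
  refine ⟨?_, ?_⟩
  · rintro ⟨_, ⟨x, rfl⟩, rfl⟩
    refine ⟨x, x.2, ?_⟩
    change P.subtype x = g * P.subtype (φ x) * g⁻¹
    rw [hφ]
    group
  · rintro ⟨x, hx, e⟩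
    refine ⟨φ ⟨x, hx⟩, ⟨_, rfl⟩, Subtype.ext ?_⟩
    refine (hφ ⟨x, hx⟩).trans ?_
    change g⁻¹ * P.subtype x * g = y
    rw [e]
    group

/-- An element inducing the extension to RQ normalises `Q`, because the extension restricts to an
automorphism of `Q`; conversely, conjugation by an element of N_G(Q) extends from R to RQ. -/
theorem normaliser_ofGroup :
    (ofGroup P).normaliser Q =
      ofEmbedding (normalizerEmbedding P Q) (normalizerEmbedding_injective P Q) := by
  ext R T φ
  constructor
  · rintro ⟨φ', ⟨g, hg⟩, h2, α, -, h4⟩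
    have hα : ∀ x : Q, ((α x : P) : G) = g⁻¹ * (x : P) * g := fun x => by
      rw [← h4]
      exact hg ⟨x, mulNorm_right x⟩
    have hgN : g ∈ normalizer ((Q.map P.subtype : Subgroup G) : Set G) := by
      rw [mem_normalizer_iff'']
      refine fun h => ⟨?_, ?_⟩
      · rintro ⟨x, hx, rfl⟩
        exact ⟨α ⟨x, hx⟩, (α ⟨x, hx⟩).2, hα ⟨x, hx⟩⟩
      · rintro ⟨x, hx, e⟩
        refine ⟨α.symm ⟨x, hx⟩, (α.symm ⟨x, hx⟩).2, ?_⟩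
        have := hα (α.symm ⟨x, hx⟩)
        rw [MulEquiv.apply_symm_apply] at this
        exact mul_left_cancel (mul_right_cancel (this.symm.trans e))
    refine ⟨⟨g, hgN⟩, fun x => Subtype.ext ?_⟩
    change (((φ x : normalizer (Q : Set P)) : P) : G) = g⁻¹ * ((x : normalizer (Q : Set P)) : P) * g
    rw [← h2]
    exact hg ⟨x, mulNorm_left x⟩
  · rintro ⟨n, hn⟩
    have hn' : ∀ x : R, (((φ x : normalizer (Q : Set P)) : P) : G) =
        (n : G)⁻¹ * ((x : normalizer (Q : Set P)) : P) * n := fun x => congrArg Subtype.val (hn x)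
    have hQ : ∀ x ∈ Q, ∃ y ∈ Q, P.subtype y = (n : G)⁻¹ * P.subtype x * n := fun x hx =>
      (mem_normalizer_iff''.1 n.2 x).1 ⟨x, hx, rfl⟩
    have hQ' : ∀ x ∈ Q, ∃ y ∈ Q, P.subtype y = (n : G)⁻¹⁻¹ * P.subtype x * (n : G)⁻¹ :=
      fun x hx => by simpa using (mem_normalizer_iff.1 n.2 x).1 ⟨x, hx, rfl⟩
    have hle : mulNorm Q R ≤
        ((mulNorm Q T).map P.subtype).comap
          ((MulAut.conj (n : G)⁻¹).toMonoidHom.comp P.subtype) := by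
      refine sup_le ?_ ?_
      · rintro _ ⟨x, hx, rfl⟩
        refine ⟨_, mulNorm_left (φ ⟨x, hx⟩), ?_⟩
        simpa using hn' ⟨x, hx⟩
      · intro x hx
        obtain ⟨y, hy, e⟩ := hQ x hx
        exact ⟨y, mulNorm_right ⟨y, hy⟩, by simpa using e⟩
    obtain ⟨φ', hφ'⟩ := exists_conj_hom P.subtype_injective (R := mulNorm Q R) (T := mulNorm Q T)
      (n : G) fun x hx => by
        obtain ⟨y, hy, e⟩ := hle hx
        exact ⟨y, hy, by simpa using e⟩
    obtain ⟨α, hα⟩ := exists_conj_hom P.subtype_injective (n : G) hQ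
    obtain ⟨β, hβ⟩ := exists_conj_hom P.subtype_injective (n : G)⁻¹ hQ'
    refine ⟨φ', ⟨n, hφ'⟩, fun x => Subtype.ext ?_, MonoidHom.toMulEquiv α β ?_ ?_, ⟨n, hα⟩,
      fun x => Subtype.ext ?_⟩
    · exact (hφ' _).trans (hn' x).symm
    · ext x
      have := hβ (α x)
      rw [hα] at this
      simpa [mul_assoc] using this
    · ext x
      have := hα (β x)
      rw [hβ] at this
      simpa [mul_assoc] using this
    · exact (hφ' _).trans (hα x).symm

end Normalizer

/-! ### Fully normalised subgroups; every model is a section of G. -/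

section Sylow

variable {p : ℕ} [Fact p.Prime] {G : Type u} [Group G] [Finite G] (P : Sylow p G)
  (Q : Subgroup (P : Subgroup G))

theorem isPGroup_range_normalizerEmbedding {p : ℕ} {G : Type u} [Group G] (P : Sylow p G)
    (Q : Subgroup (P : Subgroup G)) :
    IsPGroup p (normalizerEmbedding (P : Subgroup G) Q).range :=
  (P.2.to_subgroup (normalizer (Q : Set P))).of_surjective
    (normalizerEmbedding (P : Subgroup G) Q).rangeRestrict
    (normalizerEmbedding (P : Subgroup G) Q).rangeRestrict_surjective

/-- Conjugating a Sylow subgroup of N_G(Q) into `P` embeds it in the normaliser in `P` of a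
conjugate of `Q`; full normalisation then bounds its order by |N_P(Q)|. -/
theorem exists_sylow_eq_range_of_isFullyNormalised
    (hQ : (ofGroup (P : Subgroup G)).IsFullyNormalised Q) :
    ∃ S : Sylow p (normalizer ((Q.map (P : Subgroup G).subtype : Subgroup G) : Set G)),
      (S : Subgroup _) = (normalizerEmbedding (P : Subgroup G) Q).range := by
  obtain ⟨S, hS⟩ := (isPGroup_range_normalizerEmbedding P Q).exists_le_sylow
  refine ⟨S, (eq_of_le_of_card_ge hS ?_).symm⟩
  obtain ⟨g, hg⟩ := (S.2.map (Subgroup.subtype _)).exists_conj_mem_sylow P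
  have hmem : ∀ s : S, g * (s.1.1 : G) * g⁻¹ ∈ (P : Subgroup G) := fun s =>
    hg _ ⟨s, s.2, rfl⟩
  have hQS : ∀ x ∈ Q, ∃ s : S, (s.1.1 : G) = (x : G) := fun x hx =>
    ⟨⟨_, hS ⟨⟨x, le_normalizer hx⟩, rfl⟩⟩, rfl⟩
  obtain ⟨φ, hφ⟩ := exists_conj_hom (P : Subgroup G).subtype_injective (R := Q) (T := ⊤) g⁻¹
    fun x hx => by
      obtain ⟨s, e⟩ := hQS x hx
      exact ⟨⟨_, hmem s⟩, trivial, by simp [e]⟩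
  refine le_trans ?_ ((hQ ⊤ φ ⟨g⁻¹, hφ⟩).trans
    (Nat.card_congr (MonoidHom.ofInjective (normalizerEmbedding_injective _ Q)).toEquiv).le)
  have himg : ∀ y : (P : Subgroup G), y ∈ image φ ↔ g⁻¹ * (y : G) * g ∈
      Q.map (P : Subgroup G).subtype := by
    intro y
    simpa using mem_image_iff hφ y
  have hnorm : ∀ s : S, (⟨_, hmem s⟩ : (P : Subgroup G)) ∈
      normalizer (image φ : Set (P : Subgroup G)) := fun s => by
    rw [mem_normalizer_iff]
    intro y
    rw [himg, himg, mem_normalizer_iff.1 s.1.2]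
    congr! 1
    simp [mul_assoc]
  refine Nat.card_le_card_of_injective (fun s : S => (⟨_, hnorm s⟩ :
    normalizer (image φ : Set (P : Subgroup G)))) fun s t h => ?_
  have : g * (s.1.1 : G) * g⁻¹ = g * (t.1.1 : G) * g⁻¹ :=
    congrArg (fun z : normalizer (image φ : Set (P : Subgroup G)) => ((z : P) : G)) h
  exact Subtype.ext (Subtype.ext (mul_left_cancel (mul_right_cancel this)))

theorem involves_of_isModel (hc : (ofGroup (P : Subgroup G)).IsCentric Q)
    (hQ : (ofGroup (P : Subgroup G)).IsFullyNormalised Q) {L : Type*} [Group L] [Finite L]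
    (hL : IsModel p ((ofGroup (P : Subgroup G)).normaliser Q) L) : Involves G L := by
  obtain ⟨h1, h2, ι, hι, ⟨SL, hSL⟩, hF⟩ := hL
  obtain ⟨SN, hSN⟩ := exists_sylow_eq_range_of_isFullyNormalised P Q hQ
  rw [normaliser_ofGroup] at hF
  refine Involves.of_subgroup _ (involves_of_ofEmbedding_eq hι
    (normalizerEmbedding_injective (P : Subgroup G) Q) SL hSL SN hSN
    (Q.subgroupOf (normalizer (Q : Set P))) ?_ ?_ h1 h2 hF.symm)
  · refine ⟨?_⟩
    rintro _ ⟨x, hx, rfl⟩ n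
    obtain ⟨y, hy, e⟩ := (mem_normalizer_iff.1 n.2 _).1 ⟨x, hx, rfl⟩
    exact ⟨⟨y, le_normalizer hy⟩, hy, Subtype.ext e⟩
  · intro x hx
    have him : image (MonoidHom.id Q) = Q := by
      ext y
      constructor
      · rintro ⟨z, -, rfl⟩
        exact z.2
      · exact fun hy => ⟨⟨y, hy⟩, ⟨⟨y, hy⟩, rfl⟩, rfl⟩
    have := hc Q _ ((ofGroup (P : Subgroup G)).id_mem Q)
    rw [him] at this
    refine this (mem_centralizer_iff.2 fun q hq => ?_)
    exact congrArg Subtype.val (mem_centralizer_iff.1 hx ⟨q, le_normalizer hq⟩ hq)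

end Sylow

end FusionSystem

/-! ### Recognising Qd(p) from an induced action of SL₂(p), for p odd. -/

/-- The image of `j : T → Γ` is normalised by elements of `Γ` inducing, by way of `f : T → 𝔽_p²`, all
of `SL₂(p)` on `𝔽_p²`. -/
def InducesSL2 (p : ℕ) {T Γ : Type*} [Group T] [Group Γ] (j : T →* Γ)
    (f : T →* Multiplicative (Fin 2 → ZMod p)) : Prop :=
  ∀ σ : Matrix.SpecialLinearGroup (Fin 2) (ZMod p), ∃ m : Γ, ∀ t, ∃ t',
    j t' = m * j t * m⁻¹ ∧ f t' = Qd.action p σ (f t)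

/-- No injectivity of `ψ` is needed, so the action can be pushed to N / O_{p'}(N). -/
theorem InducesSL2.comp {p : ℕ} {T Γ Δ : Type*} [Group T] [Group Γ] [Group Δ] {j : T →* Γ}
    {f : T →* Multiplicative (Fin 2 → ZMod p)} (h : InducesSL2 p j f) (ψ : Γ →* Δ) :
    InducesSL2 p (ψ.comp j) f := fun σ => by
  obtain ⟨m, hm⟩ := h σ
  refine ⟨ψ m, fun t => ?_⟩
  obtain ⟨t', e, e'⟩ := hm t
  exact ⟨t', by simp [e], e'⟩

namespace Qd

variable {p : ℕ}

theorem eq_one_of_action_eq {σ : Matrix.SpecialLinearGroup (Fin 2) (ZMod p)}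
    (h : ∀ v, action p σ v = v) : σ = 1 := by
  apply Matrix.SpecialLinearGroup.toLin'_injective
  ext1 v
  rw [map_one]
  exact congrArg Multiplicative.toAdd (h (Multiplicative.ofAdd v))

/-- The central element `-1` of `SL₂(p)`. -/
def negOne (p : ℕ) : Matrix.SpecialLinearGroup (Fin 2) (ZMod p) := ⟨-1, by simp [Matrix.det_neg]⟩

theorem negOne_mul_self : negOne p * negOne p = 1 := Subtype.ext (by
  rw [Matrix.SpecialLinearGroup.coe_mul]
  simp [negOne])

theorem commute_negOne (σ : Matrix.SpecialLinearGroup (Fin 2) (ZMod p)) :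
    Commute σ (negOne p) := Subtype.ext (by
  rw [Matrix.SpecialLinearGroup.coe_mul, Matrix.SpecialLinearGroup.coe_mul]
  simp [negOne])

theorem action_negOne (v : Multiplicative (Fin 2 → ZMod p)) : action p (negOne p) v = v⁻¹ := by
  change Multiplicative.ofAdd ((-1 : Matrix (Fin 2) (Fin 2) (ZMod p)).mulVec v.toAdd) = v⁻¹
  rw [Matrix.neg_mulVec, Matrix.one_mulVec]
  rfl

theorem pow_eq_one (v : Multiplicative (Fin 2 → ZMod p)) : v ^ p = 1 := by
  apply Multiplicative.toAdd.injective
  ext i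
  simp

instance zpowers_negOne_normal : (zpowers (negOne p)).Normal := by
  refine ⟨?_⟩
  rintro _ ⟨k, rfl⟩ σ
  refine ⟨k, ?_⟩
  have := (commute_negOne σ).zpow_right k
  simp [this.eq]

end Qd

section Criterion

variable {p : ℕ} {T Γ : Type*} [Group T] [Group Γ]

/-- The elements of `Γ × SL₂(p)` whose two components act compatibly on `T` and on `𝔽_p²`. -/
def compatibleSubgroup [Finite T] (j : T →* Γ) (hj : Function.Injective j)
    (f : T →* Multiplicative (Fin 2 → ZMod p)) :
    Subgroup (Γ × Matrix.SpecialLinearGroup (Fin 2) (ZMod p)) where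
  carrier := {u | ∀ t, ∃ t', j t' = u.1 * j t * u.1⁻¹ ∧ f t' = Qd.action p u.2 (f t)}
  one_mem' t := ⟨t, by simp⟩
  mul_mem' := by
    intro u v hu hv t
    obtain ⟨t₁, h₁, e₁⟩ := hv t
    obtain ⟨t₂, h₂, e₂⟩ := hu t₁
    exact ⟨t₂, by simp [h₂, h₁, mul_assoc], by simp [e₂, e₁]⟩
  inv_mem' := by
    intro u hu
    choose F hF hF' using hu
    have hinj : Function.Injective F := fun s t h => by
      have := hF s
      rw [h, hF t] at this
      exact (hj (mul_left_cancel (mul_right_cancel this))).symm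
    intro t
    obtain ⟨s, rfl⟩ := Finite.surjective_of_injective hinj t
    refine ⟨s, ?_, ?_⟩
    · simp [hF, mul_assoc]
    · simp [hF']

/-- A group of compatible elements covering `SL₂(p)` and meeting the image of `T` only in the
kernel of `f`. -/
theorem exists_cover_compatibleSubgroup [Fact p.Prime] (hp : p ≠ 2) [Finite T] [Finite Γ]
    {j : T →* Γ} (hj : Function.Injective j) {f : T →* Multiplicative (Fin 2 → ZMod p)}
    (h : InducesSL2 p j f) :
    ∃ Γ₀ : Subgroup (Γ × Matrix.SpecialLinearGroup (Fin 2) (ZMod p)),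
      Γ₀ ≤ compatibleSubgroup j hj f ∧ (∀ σ, ∃ m, (m, σ) ∈ Γ₀) ∧
        ∀ t, (j t, 1) ∈ Γ₀ → f t = 1 := by
  have hp' : p.Prime := Fact.out
  let M := compatibleSubgroup j hj f
  let θ : M →* Matrix.SpecialLinearGroup (Fin 2) (ZMod p) := (MonoidHom.snd _ _).comp M.subtype
  have hθ : Function.Surjective θ := fun σ => by
    obtain ⟨m, hm⟩ := h σ
    exact ⟨⟨(m, σ), hm⟩, rfl⟩
  -- A lift of -1 raised to the odd part of its order becomes a 2-element and still lifts -1.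
  obtain ⟨s, k, hsk, hs⟩ : ∃ (s : M) (k : ℕ), s ^ 2 ^ k = 1 ∧ θ s = Qd.negOne p := by
    obtain ⟨z, hz⟩ := hθ (Qd.negOne p)
    obtain ⟨k, m, ⟨r, hr⟩, hkm⟩ := Nat.exists_eq_two_pow_mul_odd (orderOf_pos z).ne'
    refine ⟨z ^ m, k, ?_, ?_⟩
    · rw [← pow_mul, mul_comm, ← hkm, pow_orderOf_eq_one]
    · rw [map_pow, hz, hr, pow_succ, pow_mul, sq, Qd.negOne_mul_self, one_pow, one_mul]
  let D : Subgroup M := (zpowers (Qd.negOne p)).comap θ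
  have hsD : s ∈ D := ⟨1, by simp [hs]⟩
  have hs2 : IsPGroup 2 (zpowers (⟨s, hsD⟩ : D)) := by
    refine IsPGroup.of_card_dvd_pow (n := k) ?_
    rw [Nat.card_zpowers]
    exact orderOf_dvd_of_pow_eq_one (Subtype.ext hsk)
  obtain ⟨Z, hZ⟩ := hs2.exists_le_sylow
  have hsZ : s ∈ (Z : Subgroup D).map D.subtype := ⟨_, hZ (mem_zpowers _), rfl⟩
  -- Frattini argument in the preimage `D` of ⟨-1⟩. As `Z` contains `s`, its normaliser covers the
  -- image of `D` too, hence all of SL₂(p).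
  have hfr := Z.normalizer_sup_eq_top
  refine ⟨(normalizer ((Z : Subgroup D).map D.subtype : Set M)).map M.subtype, map_subtype_le _,
    fun σ => ?_, ?_⟩
  · obtain ⟨m, rfl⟩ := hθ σ
    have hm : m ∈ normalizer ((Z : Subgroup D).map D.subtype : Set M) ⊔ D := by
      rw [hfr]; trivial
    obtain ⟨γ, hγ, d, ⟨i, hi⟩, rfl⟩ := mem_sup_of_normal_right.1 hm
    refine ⟨(γ * s ^ i).1.1, γ * s ^ i, mul_mem hγ (zpow_mem (le_normalizer hsZ) i),
      Prod.ext rfl ?_⟩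
    change θ (γ * s ^ i) = θ (γ * d)
    rw [map_mul, map_mul, map_zpow, hs, ← hi]
  · rintro t ⟨a, ha, e⟩
    have ha1 : a.1.1 = j t := congrArg Prod.fst e
    have ha2 : a.1.2 = 1 := congrArg Prod.snd e
    -- The commutator of `s` and `a` is a 2-element, being in `Z`. It also comes from `T`, where `f`
    -- sends it to (f t)⁻², of order dividing p; hence f t = 1.
    have hc : s * (a * s * a⁻¹)⁻¹ ∈ (Z : Subgroup D).map D.subtype :=
      mul_mem hsZ (inv_mem ((mem_normalizer_iff.1 ha s).1 hsZ))
    obtain ⟨i, hi⟩ := (Z.2.map D.subtype) ⟨_, hc⟩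
    have hi' : (s * (a * s * a⁻¹)⁻¹) ^ 2 ^ i = 1 := congrArg Subtype.val hi
    obtain ⟨t', e₁, e₂⟩ := s.2 t
    have hs' : s.1.2 = Qd.negOne p := hs
    rw [hs', Qd.action_negOne] at e₂
    have h1 : j ((t' * t⁻¹) ^ 2 ^ i) = 1 := by
      have : (s * (a * s * a⁻¹)⁻¹).1.1 = j (t' * t⁻¹) := by
        simp [e₁, ha1, mul_assoc]
      rw [map_pow, ← this]
      exact congrArg (fun u : M => u.1.1) hi'
    have h2 : (f t)⁻¹ ^ 2 ^ (i + 1) = 1 := by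
      have := congrArg f (hj (h1.trans (map_one j).symm))
      rw [map_pow, map_mul, map_inv, e₂, map_one] at this
      rw [pow_succ', pow_mul, sq, this]
    have h3 : (f t)⁻¹ ^ p = 1 := Qd.pow_eq_one _
    have h4 : (2 ^ (i + 1)).Coprime p :=
      ((Nat.coprime_primes Nat.prime_two hp').2 hp.symm).pow_left _
    exact inv_eq_one.1 (orderOf_eq_one_iff.1 (Nat.eq_one_of_dvd_coprimes h4
      (orderOf_dvd_of_pow_eq_one h2) (orderOf_dvd_of_pow_eq_one h3)))

theorem involves_of_inducesSL2 [Fact p.Prime] (hp : p ≠ 2) [Finite Γ]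
    {j : T →* Γ} (hj : Function.Injective j) {f : T →* Multiplicative (Fin 2 → ZMod p)}
    (hf : Function.Surjective f) (h : InducesSL2 p j f) : Involves Γ (Qd p) := by
  have : Finite T := Finite.of_injective j hj
  obtain ⟨Γ₀, hΓ₀, hsurj, hker⟩ := exists_cover_compatibleSubgroup hp hj h
  refine involves_iff.2 ⟨⟨⟨⟨{w | ∃ t, ∃ u ∈ Γ₀, w.1 = j t * u.1 ∧ w.2 = ⟨f t, u.2⟩}, ?_⟩, ?_⟩, ?_⟩,
    ?_, ?_⟩
  · rintro ⟨_, _⟩ ⟨_, _⟩ ⟨t, u, hu, rfl, rfl⟩ ⟨s, v, hv, rfl, rfl⟩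
    obtain ⟨s', e, e'⟩ := hΓ₀ hu s
    refine ⟨t * s', u * v, mul_mem hu hv, ?_, ?_⟩
    · simp [e, mul_assoc]
    · ext1 <;> simp [e']
  · exact ⟨1, 1, one_mem _, by simp, by ext1 <;> simp⟩
  · rintro ⟨_, _⟩ ⟨t, u, hu, rfl, rfl⟩
    obtain ⟨s', e, e'⟩ := hΓ₀ (inv_mem hu) t⁻¹
    refine ⟨s', u⁻¹, inv_mem hu, ?_, ?_⟩
    · simp [e]
    · ext1 <;> simp [e']
  · rintro ⟨v, σ⟩
    obtain ⟨t, rfl⟩ := hf v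
    obtain ⟨m, hm⟩ := hsurj σ
    exact ⟨_, t, _, hm, rfl, rfl⟩
  · rintro _ ⟨t, ⟨m, σ⟩, hu, e, rfl⟩
    have hm : m = j t⁻¹ := by
      rw [map_inv]
      exact (inv_eq_of_mul_eq_one_right e.symm).symm
    subst hm
    -- Here `σ` acts on 𝔽_p² as conjugation by an element of `T` does, thus trivially because 𝔽_p²
    -- is abelian.
    have hσ : σ = 1 := by
      refine Qd.eq_one_of_action_eq fun v => ?_
      obtain ⟨s, rfl⟩ := hf v
      obtain ⟨s', e₁, e₂⟩ := hΓ₀ hu s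
      have : s' = t⁻¹ * s * t := hj (by simpa using e₁)
      rw [← e₂, this]
      simp
    subst hσ
    have := hker _ hu
    rw [map_inv, inv_eq_one] at this
    ext1
    · exact this
    · rfl

end Criterion

/-! ### From a section Qd(p) of G to a centric p-subgroup. -/

section Local

variable {p : ℕ} [Fact p.Prime] {G : Type u} [Group G] [Finite G]

/-- `T` is a Sylow p-subgroup of the preimage V of 𝔽_p². It maps onto this p-group, and by the
Frattini argument its normaliser covers the quotient SL₂(p). -/
theorem exists_inducesSL2_of_involves (h : Involves G (Qd p)) :
    ∃ (T : Type u) (_ : Group T) (j : T →* G) (f : T →* Multiplicative (Fin 2 → ZMod p)),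
      IsPGroup p T ∧ Function.Injective j ∧ Function.Surjective f ∧ InducesSL2 p j f := by
  obtain ⟨W, hW, hW1⟩ := involves_iff.1 h
  let a : W →* G := (MonoidHom.fst _ _).comp W.subtype
  let b : W →* Qd p := (MonoidHom.snd _ _).comp W.subtype
  have ha : Function.Injective a := by
    rw [injective_iff_map_eq_one]
    rintro ⟨⟨g, x⟩, hw⟩ (h : g = 1)
    subst h
    have := hW1 x hw
    subst this
    rfl
  have hb : Function.Surjective b := fun x => by
    obtain ⟨g, hg⟩ := hW x
    exact ⟨⟨_, hg⟩, rfl⟩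
  have : Finite W := Finite.of_injective a ha
  let V : Subgroup W := (SemidirectProduct.rightHom.comp b).ker
  have hV : ∀ v : V, (b v).right = 1 := fun v => v.2
  let c : V →* Multiplicative (Fin 2 → ZMod p) := MonoidHom.mk' (fun v => (b v).left) fun v w => by
    simp [hV]
  have hc : Function.Surjective c := fun v => by
    obtain ⟨w, hw⟩ := hb (SemidirectProduct.inl v)
    exact ⟨⟨w, by simp [V, MonoidHom.mem_ker, hw]⟩, by simp [c, hw]⟩
  let T : Sylow p V := default
  have hT : ((T : Subgroup V).map c) = ⊤ := by
    rw [← Sylow.coe_mapSurjective hc]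
    refine ((T.mapSurjective hc).3 (Q := ⊤) ?_ le_top).symm
    rintro ⟨v, -⟩
    exact ⟨1, Subtype.ext (by simpa using Qd.pow_eq_one v)⟩
  refine ⟨T, inferInstance, (a.comp V.subtype).comp (T : Subgroup V).subtype,
    c.comp (T : Subgroup V).subtype, T.2,
    (ha.comp V.subtype_injective).comp (T : Subgroup V).subtype_injective, fun v => ?_, fun σ => ?_⟩
  · have : v ∈ (T : Subgroup V).map c := by rw [hT]; trivial
    obtain ⟨t, ht, e⟩ := this
    exact ⟨⟨t, ht⟩, e⟩
  · obtain ⟨w, hw⟩ := hb (SemidirectProduct.inr σ)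
    have hwN : w ∈ normalizer ((T : Subgroup V).map V.subtype : Set W) ⊔ V := by
      rw [T.normalizer_sup_eq_top]; trivial
    obtain ⟨m, hm, v, hv, rfl⟩ := mem_sup_of_normal_right.1 hwN
    have hmσ : (b m).right = σ := by
      have := congrArg SemidirectProduct.right hw
      have hv' : (b v).right = 1 := hv
      simpa [hv'] using this
    refine ⟨a m, fun t => ?_⟩
    obtain ⟨t', ht', e⟩ := (mem_normalizer_iff.1 hm _).1 ⟨t.1, t.2, rfl⟩
    refine ⟨⟨t', ht'⟩, ?_, ?_⟩
    · simpa using congrArg a e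
    · change (b t').left = Qd.action p σ (b t.1).left
      have : b t' = b m * b t.1 * (b m)⁻¹ := by simpa using congrArg b e
      rw [this]
      simp [hV, hmσ]

/-- The `p`-subgroup carrying the action of `SL₂(p)` can be enlarged to one which contains the
`p`-elements of its centraliser, and whose normaliser still induces `SL₂(p)`. -/
theorem exists_centric_of_inducesSL2 {T : Type*} [Group T] (hT : IsPGroup p T) {j : T →* G}
    (hj : Function.Injective j) {f : T →* Multiplicative (Fin 2 → ZMod p)}
    (h : InducesSL2 p j f) :
    ∃ Q : Subgroup G, IsPGroup p Q ∧
      (∀ x ∈ centralizer (Q : Set G), (∃ k, x ^ p ^ k = 1) → x ∈ Q) ∧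
      ∃ hQ : ∀ t, j t ∈ normalizer (Q : Set G), InducesSL2 p (j.codRestrict _ hQ) f := by
  have : Finite T := Finite.of_injective j hj
  let C : Subgroup G := centralizer (j.range : Set G)
  have hC : ∀ x, x ∈ C ↔ ∀ t, j t * x = x * j t := fun x => by
    rw [mem_centralizer_iff]
    exact ⟨fun h t => h _ ⟨t, rfl⟩, by rintro h _ ⟨t, rfl⟩; exact h t⟩
  let D : Sylow p C := default
  let D' : Subgroup G := (D : Subgroup C).map C.subtype
  have hD'p : IsPGroup p D' := D.2.map _
  have hD'C : D' ≤ C := map_subtype_le _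
  have hjp : IsPGroup p j.range := hT.of_surjective j.rangeRestrict j.rangeRestrict_surjective
  have hQp : IsPGroup p (j.range ⊔ D' : Subgroup G) :=
    hjp.to_sup_of_normal_left' hD'p (hD'C.trans (centralizer_le_normalizer _))
  refine ⟨j.range ⊔ D', hQp, ?_, fun t => le_normalizer (mem_sup_left ⟨t, rfl⟩), fun σ => ?_⟩
  · rintro x hx ⟨k, hk⟩
    have hxC : x ∈ C := centralizer_le (SetLike.coe_subset_coe.2 le_sup_left) hx
    have hxp : IsPGroup p (zpowers (⟨x, hxC⟩ : C)) := by
      refine IsPGroup.of_card_dvd_pow (n := k) ?_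
      rw [Nat.card_zpowers]
      exact orderOf_dvd_of_pow_eq_one (Subtype.ext hk)
    have hxn : zpowers (⟨x, hxC⟩ : C) ≤ normalizer (D : Set C) := by
      rw [zpowers_le]
      refine centralizer_le_normalizer _ (mem_centralizer_iff.2 fun d hd => Subtype.ext ?_)
      exact mem_centralizer_iff.1 hx d (mem_sup_right ⟨d, hd, rfl⟩)
    -- `x` centralises `D`, so D⟨x⟩ is a p-subgroup of `C`; maximality puts `x` in `D`.
    have := D.3 (D.2.to_sup_of_normal_left' hxp hxn) le_sup_left
    refine mem_sup_right ⟨⟨x, hxC⟩, ?_, rfl⟩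
    change _ ∈ (D : Subgroup C)
    rw [← this]
    exact mem_sup_right (mem_zpowers _)
  · obtain ⟨m, hm⟩ := h σ
    choose F hF hF' using hm
    have hsurj : Function.Surjective F := Finite.surjective_of_injective fun s t e => by
      have := hF s
      rw [e, hF t] at this
      exact (hj (mul_left_cancel (mul_right_cancel this))).symm
    have hmC : ∀ x ∈ C, m * x * m⁻¹ ∈ C := fun x hx => by
      rw [hC] at hx ⊢
      intro t
      obtain ⟨s, rfl⟩ := hsurj t
      rw [hF]
      calc m * j s * m⁻¹ * (m * x * m⁻¹) = m * (j s * x) * m⁻¹ := by group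
        _ = m * x * m⁻¹ * (m * j s * m⁻¹) := by rw [hx]; group
    have hmp : IsPGroup p ((D'.map (MulAut.conj m).toMonoidHom).subgroupOf C) :=
      (hD'p.map _).comap_subtype
    -- `m` normalises `C` but may move `D`; a factor `c` from `C` moves it back without changing the
    -- action on `T`.
    obtain ⟨c, hc⟩ := hmp.exists_conj_mem_sylow D
    have hc' : ∀ t, c * j t * (c : G)⁻¹ = j t := fun t => by
      rw [← (hC c).1 c.2 t, mul_inv_cancel_right]
    have hn : (c : G) * m ∈ normalizer ((j.range ⊔ D' : Subgroup G) : Set G) := by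
      have hle : j.range ⊔ D' ≤ (j.range ⊔ D').comap (MulAut.conj ((c : G) * m)).toMonoidHom := by
        refine sup_le ?_ ?_
        · rintro _ ⟨t, rfl⟩
          refine mem_sup_left ⟨F t, ?_⟩
          rw [← hc' (F t), hF]
          simp [mul_assoc]
        · intro d hd
          refine mem_sup_right ⟨_, hc ⟨m * d * m⁻¹, hmC d (hD'C hd)⟩ ⟨d, hd, rfl⟩, ?_⟩
          simp [mul_assoc]
      exact mem_normalizer_fintype fun x hx => hle hx
    refine ⟨⟨_, hn⟩, fun t => ⟨F t, Subtype.ext ?_, hF' t⟩⟩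
    change j (F t) = c * m * j t * (c * m)⁻¹
    rw [← hc' (F t), hF]
    simp [mul_assoc]

end Local

/-! ### N / O_{p'}(N) as a model. -/

namespace FusionSystem

/-- The quotient by `O_{p'}(N)` does not change the fusion system. -/
theorem ofEmbedding_eq_of_quotient_pPrimeCore {p : ℕ} [Fact p.Prime] {S N : Type*} [Group S]
    [Group N] [Finite N] {κ : S →* N} (hκ : Function.Injective κ) (hS : IsPGroup p S)
    (hι : Function.Injective ((QuotientGroup.mk' (pPrimeCore p N)).comp κ)) :
    ofEmbedding κ hκ = ofEmbedding ((QuotientGroup.mk' (pPrimeCore p N)).comp κ) hι := by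
  let K := pPrimeCore p N
  ext R T φ
  constructor
  · rintro ⟨n, hn⟩
    refine ⟨QuotientGroup.mk' K n, fun x => ?_⟩
    simp only [MonoidHom.comp_apply, hn, map_mul, map_inv, K]
  · rintro ⟨l, hl⟩
    obtain ⟨n, rfl⟩ := QuotientGroup.mk'_surjective _ l
    have hn : ∀ x : R, (n⁻¹ * κ x * n)⁻¹ * κ (φ x) ∈ K := fun x => by
      rw [← QuotientGroup.eq]
      exact (hl x).symm
    have hp : ∀ X : Subgroup S, IsPGroup p (X.map κ) := fun X => (hS.to_subgroup X).map κ
    let E : Subgroup N := K ⊔ T.map κ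
    have hTE : IsPGroup p ((T.map κ).subgroupOf E) := (hp T).comap_subtype
    obtain ⟨T', hT'⟩ := hTE.exists_le_sylow
    -- In E = K κ(T) the subgroup κ(T) is Sylow, since a p-subgroup meets `K` trivially. So the
    -- n-conjugate of κ(R), which lies in E, can be moved into κ(T) by an element of `K`.
    have hT'T : ∀ x ∈ (T' : Subgroup E), (x : N) ∈ T.map κ := fun x hx => by
      obtain ⟨k, hk, t, ht, e⟩ := mem_sup_of_normal_left.1 x.2
      have htE : t ∈ E := mem_sup_right ht
      have h1 : x * (⟨t, htE⟩ : E)⁻¹ ∈ (T' : Subgroup E) :=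
        mul_mem hx (inv_mem (hT' (show (⟨t, htE⟩ : E) ∈ (T.map κ).subgroupOf E from ht)))
      have h2 : (x * (⟨t, htE⟩ : E)⁻¹ : E).1 = k := by simp [← e]
      have h3 : k = 1 := (T'.2.map E.subtype).eq_one_of_coprime coprime_card_pPrimeCore
        ⟨_, h1, h2⟩ hk
      rw [← e, h3, one_mul]
      exact ht
    have hRE : ∀ x : R, n⁻¹ * κ x * n ∈ E := fun x => by
      have h1 : n⁻¹ * κ x * n = κ (φ x) * ((n⁻¹ * κ x * n)⁻¹ * κ (φ x))⁻¹ := by group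
      rw [h1]
      exact mul_mem (mem_sup_right ⟨_, (φ x).2, rfl⟩) (mem_sup_left (inv_mem (hn x)))
    have hRp : IsPGroup p (((R.map κ).map (MulAut.conj n⁻¹).toMonoidHom).subgroupOf E) :=
      ((hp R).map _).comap_subtype
    obtain ⟨e, he⟩ := hRp.exists_conj_mem_sylow T'
    obtain ⟨t, ht, k, hk, hkt⟩ := mem_sup_of_normal_right.1 (sup_comm K (T.map κ) ▸ e.2 :
      (e : N) ∈ T.map κ ⊔ K)
    have hk' : ∀ x : R, k * (n⁻¹ * κ x * n) * k⁻¹ ∈ T.map κ := fun x => by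
      have h1 := hT'T _ (he ⟨_, hRE x⟩ ⟨κ x, ⟨x, x.2, rfl⟩, by simp⟩)
      have h2 : k * (n⁻¹ * κ x * n) * k⁻¹ = t⁻¹ * (e * (n⁻¹ * κ x * n) * (e : N)⁻¹) * t := by
        rw [← hkt]; group
      rw [h2]
      exact mul_mem (mul_mem (inv_mem ht) h1) ht
    refine ⟨n * k⁻¹, fun x => ?_⟩
    have h1 : κ (φ x) * (k * (n⁻¹ * κ x * n) * k⁻¹)⁻¹ ∈ T.map κ :=
      mul_mem ⟨_, (φ x).2, rfl⟩ (inv_mem (hk' x))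
    have h2 : κ (φ x) * (k * (n⁻¹ * κ x * n) * k⁻¹)⁻¹ ∈ K := by
      rw [← QuotientGroup.ker_mk' K, MonoidHom.mem_ker]
      have hkK : QuotientGroup.mk' K k = 1 := by
        rwa [← MonoidHom.mem_ker, QuotientGroup.ker_mk']
      have hlx : QuotientGroup.mk' K (κ (φ x)) = QuotientGroup.mk' K (n⁻¹ * κ x * n) := hl x
      rw [map_mul, map_inv, map_mul, map_mul, map_inv, hkK, hlx]
      simp
    -- The two elements of κ(T) agree modulo `K`, and κ(T) ∩ K = 1.
    have h3 := mul_inv_eq_one.1 ((hp T).eq_one_of_coprime coprime_card_pPrimeCore h1 h2)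
    rw [h3]
    group

/-- If the `p`-elements centralising the normal `p`-subgroup `Q` of `N` lie in `Q`, then
`N / O_{p'}(N)` is a model of the fusion system of `N`. -/
theorem isModel_quotient_pPrimeCore {p : ℕ} [Fact p.Prime] {S N : Type*} [Group S]
    [Group N] [Finite N] {κ : S →* N} (hκ : Function.Injective κ)
    (SN : Sylow p N) (hSN : (SN : Subgroup N) = κ.range)
    (Q : Subgroup N) (hQN : Q.Normal) (hQp : IsPGroup p Q)
    (hcen : ∀ x ∈ centralizer (Q : Set N), (∃ k, x ^ p ^ k = 1) → x ∈ Q) :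
    IsModel p (ofEmbedding κ hκ) (N ⧸ pPrimeCore p N) := by
  let K := pPrimeCore p N
  let π := QuotientGroup.mk' K
  have hπ : Function.Surjective π := QuotientGroup.mk'_surjective K
  have hker : ∀ x, π x = 1 ↔ x ∈ K := fun x => QuotientGroup.eq_one_iff x
  have hS : IsPGroup p S :=
    (hSN ▸ SN.2 : IsPGroup p κ.range).of_injective κ.rangeRestrict
      fun x y h => hκ (congrArg Subtype.val h)
  have hι : Function.Injective (π.comp κ) := by
    rw [injective_iff_map_eq_one]
    intro x hx
    refine hκ ((SN.2.eq_one_of_coprime coprime_card_pPrimeCore (hSN ▸ ⟨x, rfl⟩)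
      ((hker _).1 hx)).trans (map_one κ).symm)
  have hQ'n : (Q.map π).Normal := hQN.map π hπ
  have hQ'p : IsPGroup p (Q.map π) := hQp.map π
  have hcen' : centralizer (Q.map π : Set (N ⧸ K)) ≤ Q.map π := by
    intro l hl
    obtain ⟨n, rfl⟩ := hπ l
    -- The centraliser lifts: commutators of `n` with `Q` lie in Q ∩ K = 1.
    have hn : n ∈ centralizer (Q : Set N) := by
      refine mem_centralizer_iff.2 fun q hq => ?_
      have h1 : q * (n * q⁻¹ * n⁻¹) ∈ Q := mul_mem hq (hQN.conj_mem _ (inv_mem hq) n)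
      have h2 : q * (n * q⁻¹ * n⁻¹) ∈ K := by
        rw [← hker]
        have := mem_centralizer_iff.1 hl (π q) ⟨q, hq, rfl⟩
        simp only [map_mul, map_inv]
        rw [← mul_assoc, ← mul_assoc, this]
        group
      have h3 := hQp.eq_one_of_coprime coprime_card_pPrimeCore h1 h2
      calc q * n = q * (n * q⁻¹ * n⁻¹) * (n * q) := by group
        _ = n * q := by rw [h3, one_mul]
    obtain ⟨q, hq, k, hk, rfl⟩ := mem_sup_of_normal_right.1
      (centralizer_le_sup_pPrimeCore (p := p) Q hcen hn)
    refine ⟨q, hq, ?_⟩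
    rw [map_mul, (hker k).2 hk, mul_one]
  refine ⟨?_, ?_, π.comp κ, hι, ⟨SN.mapSurjective hπ, ?_⟩,
    ofEmbedding_eq_of_quotient_pPrimeCore hκ hS hι⟩
  · have hle : Q.map π ≤ pCore p (N ⧸ K) := le_pCore hQ'n hQ'p
    exact (centralizer_le (SetLike.coe_subset_coe.2 hle)).trans (hcen'.trans hle)
  · rw [eq_bot_iff]
    refine sSup_le fun X hX x hx => ?_
    have hdisj : Disjoint X (Q.map π) := by
      rw [disjoint_def]
      exact fun h1 h2 => hQ'p.eq_one_of_coprime hX.2 h2 h1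
    have hxQ : x ∈ Q.map π := hcen' (mem_centralizer_iff.2 fun q hq =>
      (commute_of_normal_of_disjoint _ _ hX.1 hQ'n hdisj x q hx hq).eq.symm)
    exact hQ'p.eq_one_of_coprime hX.2 hxQ hx
  · rw [Sylow.coe_mapSurjective, hSN, MonoidHom.range_comp]

/-! ### Placing Q inside P, and the model that involves Qd(p). -/

section Sylow

variable {p : ℕ} [Fact p.Prime] {G : Type u} [Group G] [Finite G] (P : Sylow p G)

/-- The normaliser in `P` of any conjugate of `Q` is conjugate to a p-subgroup of N_G(Q), so it is
no larger than a Sylow subgroup there. -/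
theorem isFullyNormalised_of_sylow {Q : Subgroup (P : Subgroup G)}
    (S : Sylow p (normalizer ((Q.map (P : Subgroup G).subtype : Subgroup G) : Set G)))
    (hS : (S : Subgroup _) = (normalizerEmbedding (P : Subgroup G) Q).range) :
    (ofGroup (P : Subgroup G)).IsFullyNormalised Q := by
  rintro R φ ⟨g, hφ⟩
  have him := mem_image_iff hφ
  have hmem : ∀ x ∈ normalizer (image φ : Set (P : Subgroup G)),
      g * (x : G) * g⁻¹ ∈ normalizer ((Q.map (P : Subgroup G).subtype : Subgroup G) : Set G) := by
    intro x hx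
    refine mem_normalizer_fintype ?_
    rintro _ ⟨q, hq, rfl⟩
    have h2 : (φ ⟨q, hq⟩ : P) ∈ image φ := ⟨_, ⟨_, rfl⟩, rfl⟩
    have h3 := (him _).1 ((mem_normalizer_iff.1 hx _).1 h2)
    have h4 : (((φ ⟨q, hq⟩ : R) : P) : G) = g⁻¹ * (P : Subgroup G).subtype q * g := hφ ⟨q, hq⟩
    simp only [Subgroup.coe_mul, Subgroup.coe_inv, h4] at h3
    simpa [mul_assoc] using h3
  let ψ : normalizer (image φ : Set (P : Subgroup G)) →*
      normalizer ((Q.map (P : Subgroup G).subtype : Subgroup G) : Set G) :=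
    ((MulAut.conj g).toMonoidHom.comp ((P : Subgroup G).subtype.comp
      (Subgroup.subtype _))).codRestrict _ fun x => hmem x x.2
  have hψ : Function.Injective ψ := fun x y h => by
    have : g * (x.1.1 : G) * g⁻¹ = g * (y.1.1 : G) * g⁻¹ := congrArg Subtype.val h
    exact Subtype.ext (Subtype.ext (mul_left_cancel (mul_right_cancel this)))
  have hp : IsPGroup p ψ.range :=
    (P.2.to_subgroup (normalizer (image φ : Set (P : Subgroup G)))).of_surjective
      ψ.rangeRestrict ψ.rangeRestrict_surjective
  obtain ⟨S', hS'⟩ := hp.exists_le_sylow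
  calc Nat.card (normalizer (image φ : Set (P : Subgroup G))) = Nat.card ψ.range :=
        Nat.card_congr (MonoidHom.ofInjective hψ).toEquiv
    _ ≤ Nat.card S' := card_le_of_le hS'
    _ = Nat.card S := Nat.card_congr (S'.equiv S).toEquiv
    _ = Nat.card (normalizerEmbedding (P : Subgroup G) Q).range := by rw [← hS]
    _ = Nat.card (normalizer (Q : Set (P : Subgroup G))) :=
        (Nat.card_congr (MonoidHom.ofInjective
          (normalizerEmbedding_injective (P : Subgroup G) Q)).toEquiv).symm

/-- The hypothesis concerns p-elements of all of G, so it is invariant under conjugation and covers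
every conjugate of `Q` in `P` at once. -/
theorem isCentric_of_forall_mem {p : ℕ} {G : Type u} [Group G] (P : Sylow p G)
    {Q : Subgroup (P : Subgroup G)}
    (h : ∀ x ∈ centralizer ((Q.map (P : Subgroup G).subtype : Subgroup G) : Set G),
      (∃ k, x ^ p ^ k = 1) → x ∈ Q.map (P : Subgroup G).subtype) :
    (ofGroup (P : Subgroup G)).IsCentric Q := by
  rintro R φ ⟨g, hφ⟩ x hx
  rw [mem_image_iff hφ]
  refine h _ (mem_centralizer_iff.2 ?_) ?_
  · rintro _ ⟨q, hq, rfl⟩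
    have h2 : (φ ⟨q, hq⟩ : P) ∈ image φ := ⟨_, ⟨_, rfl⟩, rfl⟩
    have h3 : P.1.subtype (φ ⟨q, hq⟩) * x = x * P.1.subtype (φ ⟨q, hq⟩) :=
      congrArg Subtype.val (mem_centralizer_iff.1 hx _ h2)
    have h4 : P.1.subtype (φ ⟨q, hq⟩) = g⁻¹ * P.1.subtype q * g := hφ ⟨q, hq⟩
    rw [h4] at h3
    calc P.1.subtype q * (g * x * g⁻¹) = g * (g⁻¹ * P.1.subtype q * g * x) * g⁻¹ := by group
      _ = g * x * g⁻¹ * P.1.subtype q := by rw [h3]; group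
  · obtain ⟨k, hk⟩ := P.2 x
    refine ⟨k, ?_⟩
    have hk' : (x : G) ^ p ^ k = 1 := congrArg Subtype.val hk
    rw [conj_pow, hk']
    group

/-- Every `p`-subgroup of `G` is conjugate to a subgroup `Q` of `P` such that `N_P(Q)` is a Sylow
subgroup of `N_G(Q)`. -/
theorem exists_conj_sylow_normalizer {Q₀ : Subgroup G} (hQ₀ : IsPGroup p Q₀) :
    ∃ (g : G) (Q : Subgroup (P : Subgroup G)),
      Q.map (P : Subgroup G).subtype = Q₀.map (MulAut.conj g).toMonoidHom ∧
      ∃ S : Sylow p (normalizer ((Q.map (P : Subgroup G).subtype : Subgroup G) : Set G)),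
        (S : Subgroup _) = (normalizerEmbedding (P : Subgroup G) Q).range := by
  have hn : IsPGroup p (Q₀.subgroupOf (normalizer (Q₀ : Set G))) := hQ₀.comap_subtype
  let S₀ : Sylow p (normalizer (Q₀ : Set G)) := default
  have hQS : Q₀.subgroupOf (normalizer (Q₀ : Set G)) ≤ S₀ := hn.le_sylow_of_normal S₀
  obtain ⟨g, hg⟩ := (S₀.2.map (Subgroup.subtype _)).exists_conj_mem_sylow P
  have hQP : Q₀.map (MulAut.conj g).toMonoidHom ≤ (P : Subgroup G) := by
    rintro _ ⟨x, hx, rfl⟩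
    exact hg x ⟨⟨x, le_normalizer hx⟩, hQS hx, rfl⟩
  have hQ := map_subgroupOf_eq_of_le hQP
  refine ⟨g, (Q₀.map (MulAut.conj g).toMonoidHom).subgroupOf P, hQ, ?_⟩
  generalize hQdef : (Q₀.map (MulAut.conj g).toMonoidHom).subgroupOf P = Q at *
  have hN : (normalizer (Q₀ : Set G)).map (MulAut.conj g).toMonoidHom =
      normalizer ((Q.map (P : Subgroup G).subtype : Subgroup G) : Set G) := by
    rw [hQ]
    exact map_equiv_normalizer_eq Q₀ (MulAut.conj g)
  let ψ := ((MulAut.conj g).subgroupMap (normalizer (Q₀ : Set G))).trans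
    (MulEquiv.subgroupCongr hN)
  have hψ : ∀ x, (ψ x : G) = g * x * g⁻¹ := fun x => rfl
  let S := S₀.mapSurjective (f := ψ.toMonoidHom) ψ.surjective
  refine ⟨S, (S.3 (isPGroup_range_normalizerEmbedding P Q) ?_).symm⟩
  rintro _ ⟨s, hs, rfl⟩
  have hsP : g * (s : G) * g⁻¹ ∈ (P : Subgroup G) := hg _ ⟨s, hs, rfl⟩
  refine ⟨⟨⟨_, hsP⟩, ?_⟩, Subtype.ext rfl⟩
  refine mem_normalizer_fintype fun x hx => ?_
  obtain ⟨y, hy, e⟩ := (mem_normalizer_iff.1 (ψ s).2 _).1 ⟨x, hx, rfl⟩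
  have : y = ⟨_, hsP⟩ * x * ⟨_, hsP⟩⁻¹ := Subtype.ext e
  exact this ▸ hy

/-- If `G` involves `Qd(p)`, then so does a model of the normaliser of some centric fully
normalised subgroup. -/
theorem exists_model_of_involves (hp : p ≠ 2) (h : Involves G (Qd p)) :
    ∃ Q : Subgroup (P : Subgroup G), (ofGroup (P : Subgroup G)).IsCentric Q ∧
      (ofGroup (P : Subgroup G)).IsFullyNormalised Q ∧
      ∃ (L : Type u) (_ : Group L) (_ : Finite L),
        IsModel p ((ofGroup (P : Subgroup G)).normaliser Q) L ∧ Involves L (Qd p) := by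
  obtain ⟨T, _, j, f, hT, hj, hf, hind⟩ := exists_inducesSL2_of_involves h
  obtain ⟨Q₀, hQ₀, hcen₀, hjN, hind₀⟩ := exists_centric_of_inducesSL2 hT hj hind
  obtain ⟨g, Q, hQ, S, hS⟩ := exists_conj_sylow_normalizer P hQ₀
  have hcen : ∀ x ∈ centralizer ((Q.map (P : Subgroup G).subtype : Subgroup G) : Set G),
      (∃ k, x ^ p ^ k = 1) → x ∈ Q.map (P : Subgroup G).subtype := by
    rw [hQ]
    rintro x hx ⟨k, hk⟩
    refine ⟨g⁻¹ * x * g, hcen₀ _ (mem_centralizer_iff.2 fun q hq => ?_) ⟨k, ?_⟩, ?_⟩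
    · have : g * q * g⁻¹ * x = x * (g * q * g⁻¹) := mem_centralizer_iff.1 hx _ ⟨q, hq, rfl⟩
      calc q * (g⁻¹ * x * g) = g⁻¹ * (g * q * g⁻¹ * x) * g := by group
        _ = g⁻¹ * x * g * q := by rw [this]; group
    · have := conj_pow (i := p ^ k) (a := g⁻¹) (b := x)
      rw [inv_inv, hk] at this
      simpa using this
    · simp [mul_assoc]
  refine ⟨Q, isCentric_of_forall_mem P hcen, isFullyNormalised_of_sylow P S hS,
    normalizer ((Q.map (P : Subgroup G).subtype : Subgroup G) : Set G) ⧸ pPrimeCore p _,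
    inferInstance, inferInstance, ?_, ?_⟩
  · rw [normaliser_ofGroup]
    refine isModel_quotient_pPrimeCore (normalizerEmbedding_injective (P : Subgroup G) Q) S hS
      ((Q.map (P : Subgroup G).subtype).subgroupOf _) inferInstance
      (((P.2.to_subgroup Q).map (P : Subgroup G).subtype).comap_subtype) ?_
    rintro x hx ⟨k, hk⟩
    refine hcen x (mem_centralizer_iff.2 fun q hq => ?_) ⟨k, congrArg Subtype.val hk⟩
    exact congrArg Subtype.val (mem_centralizer_iff.1 hx ⟨q, le_normalizer hq⟩ hq)
  · have hN : (normalizer (Q₀ : Set G)).map (MulAut.conj g).toMonoidHom =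
        normalizer ((Q.map (P : Subgroup G).subtype : Subgroup G) : Set G) := by
      rw [hQ]
      exact map_equiv_normalizer_eq Q₀ (MulAut.conj g)
    let ψ := ((MulAut.conj g).subgroupMap (normalizer (Q₀ : Set G))).trans
      (MulEquiv.subgroupCongr hN)
    have hinj : Function.Injective (ψ.toMonoidHom.comp (j.codRestrict _ hjN)) := by
      intro s t e
      exact hj (congrArg Subtype.val (ψ.injective e))
    refine involves_of_inducesSL2 hp ?_ hf
      ((hind₀.comp ψ.toMonoidHom).comp (QuotientGroup.mk' (pPrimeCore p _)))
    -- `T` is a p-group, so it embeds in the quotient by O_{p'}(N).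
    rw [injective_iff_map_eq_one]
    intro t ht
    refine hinj (Eq.trans ?_ (map_one _).symm)
    refine (hT.of_surjective _ (MonoidHom.rangeRestrict_surjective
      (ψ.toMonoidHom.comp (j.codRestrict _ hjN)))).eq_one_of_coprime coprime_card_pPrimeCore
      ⟨t, rfl⟩ ((QuotientGroup.eq_one_iff _).1 ht)

end Sylow

end FusionSystem

theorem mainTheorem3 (p : ℕ) [Fact p.Prime] (hp : p ≠ 2) (G : Type u) [Group G] [Finite G]
    (P : Sylow p G) :
    (FusionSystem.ofGroup (P : Subgroup G)).IsQdFree p ↔ ¬ Involves G (Qd p) := by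
  constructor
  · intro h hG
    obtain ⟨Q, hc, hn, L, _, _, hL, hLQ⟩ := FusionSystem.exists_model_of_involves P hp hG
    exact h Q hc hn L hL hLQ
  · intro h Q hc hn L _ _ hL hLQ
    exact h ((FusionSystem.involves_of_isModel P Q hc hn hL).trans hLQ)
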